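/- Throughout, $\Sigma$ and $\Gamma$ are disjoint finite nonempty alphabets (input and output alphabet; they are part of the input of the problems below). A word $w\in(\Sigma\cup\Gamma)^*$ is a synchronization of the pair $(u,v)\in\Sigma^*\times\Gamma^*$, where $u$ (resp. $v$) is obtained from $w$ by deleting all letters of $\Gamma$ (resp. $\Sigma$). A language $S\subseteq(\Sigma\cup\Gamma)^*$ defines the relation $[\![S]\!]\subseteq\Sigma^*\times\Gamma^*$ of all pairs that have a synchronization in $S$. A relation is automatic if it equals $[\![S]\!]$ for a regular language $S\subseteq(\Sigma\Gamma)^*(\Sigma^*+\Gamma^*)$, and it is given by a finite automaton for such an $S$. A subsequential transducer has a finite state set $Q$, an initial state $q_0$, a partial transition function $Q\times\Sigma\to\Gamma^*\times Q$, a set $F\subseteq Q$ of final states and a final output function $f\colon F\to\Gamma^*$. If its run from $q_0$ on $a_1\cdots a_n$ outputs $v_i$ when reading $a_i$ and ends in $p\in F$, then it computes the output $v_1\cdots v_nf(p)$ on the input $a_1\cdots a_n$, and $a_1v_1a_2v_2\cdots a_nv_nf(p)$ is the synchronization of this run; on all other inputs the output is undefined. The transducer uniformizes a relation $R\subseteq\Sigma^*\times\Gamma^*$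 if the partial function that it computes has domain $\mathrm{dom}(R)=\{u\mid (u,v)\in R \text{ for some } v\}$ and its graph is contained in $R$. It is $S$-controlled, for a language $S\subseteq(\Sigma\cup\Gamma)^*$, if the synchronizations of all its accepting runs belong to $S$. It is $L$-controlled, for a control language $L\subseteq\{1,2\}^*$, if replacing every input letter by $1$ and every output letter by $2$ in the synchronization of any accepting run yields a word of $L$. **Theorem.** It is undecidable whether, given an automatic relation $R$ and a regular control language $L\subseteq\{1,2\}^*$ (by a finite automaton), $R$ has a uniformization by an $L$-controlled subsequential transducer. Likewise, it is undecidable whether, given an automatic relation $R\subseteq\Sigma^*\times\Gamma^*$ and a regular synchronization language $S\subseteq(\Sigma\cup\Gamma)^*$ (by a finite automaton), $R$ has a uniformization by an $S$-controlled subsequential transducer. Undecidable means that no algorithm halts with the correct answer on all such instances. -/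

import Mathlib

open scoped Computability

/-! ### Finitely presented automata -/

/-- A nondeterministic finite automaton over the alphabet `α`, given explicitly: the states are
`0, …, states - 1`, there is one initial state, a finite list of transitions and a finite list of
final states. -/
structure FinNFA (α : Type) where
  states : ℕ
  init : Fin states
  trans : List (Fin states × α × Fin states)
  final : List (Fin states)

/-- The automaton as an `NFA` in the sense of Mathlib. -/
def FinNFA.toNFA {α : Type} (A : FinNFA α) : NFA α (Fin A.states) where
  step p a := {q | (p, a, q) ∈ A.trans}
  start := {A.init}
  accept := {q | q ∈ A.final}

/-- The regular language recognized by the automaton. -/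
def FinNFA.language {α : Type} (A : FinNFA α) : Language α := A.toNFA.accepts

/-- The untyped data of an automaton: number of states, initial state, transitions, final states;
letters are coded by elements of `γ`. -/
abbrev NFACode (γ : Type) : Type := ℕ × ℕ × List (ℕ × γ × ℕ) × List ℕ

/-- Writing down an automaton, given a way `c` of writing down its letters. -/
def FinNFA.code {α γ : Type} (c : α → γ) (A : FinNFA α) : NFACode γ :=
  (A.states, A.init.val, A.trans.map fun t => (t.1.val, c t.2.1, t.2.2.val),
    A.final.map Fin.val)

/-! ### Synchronization languages

Disjointness of the input alphabet `α` and the output alphabet `β` is obtained by working over the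
disjoint sum `α ⊕ β`. -/

/-- The pair (input word, output word) of which `w` is a synchronization. -/
def syncPair {α β : Type} (w : List (α ⊕ β)) : List α × List β :=
  (w.filterMap Sum.getLeft?, w.filterMap Sum.getRight?)

/-- The relation defined by a synchronization language. -/
def syncRel {α β : Type} (S : Language (α ⊕ β)) : Set (List α × List β) :=
  {p | ∃ w ∈ S, syncPair w = p}

/-- The language of all one-letter input words. -/
def inputLetters (α β : Type) : Language (α ⊕ β) := {w | ∃ a : α, w = [Sum.inl a]}

/-- The language of all one-letter output words. -/
def outputLetters (α β : Type) : Language (α ⊕ β) := {w | ∃ b : β, w = [Sum.inr b]}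

/-- The synchronization language `(ΣΓ)*(Σ* + Γ*)` where `Σ = α` and `Γ = β`. -/
def synchronous (α β : Type) : Language (α ⊕ β) :=
  (inputLetters α β * outputLetters α β)∗ * ((inputLetters α β)∗ + (outputLetters α β)∗)

/-! ### Control languages -/

/-- The alphabet `{1, 2}` of control languages. -/
inductive Tape
  | one
  | two

/-- The number of a tape. -/
def Tape.toNat : Tape → ℕ
  | .one => 1
  | .two => 2

/-- The tape on which a letter is written. -/
def tapeOf {α β : Type} : α ⊕ β → Tape
  | .inl _ => .one
  | .inr _ => .two

/-- The synchronization language over `α ⊕ β` that corresponds to a control language: every `1` is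
substituted by `α` and every `2` by `β`. -/
def controlSync {α β : Type} (L : Language Tape) : Language (α ⊕ β) := {w | w.map tapeOf ∈ L}

/-! ### Subsequential transducers -/

/-- A subsequential transducer with input alphabet `α`, output alphabet `β` and state set `Q`:
a partial transition function, which reads one input letter and writes an output word, and a final
output function, which is defined exactly at the final states. -/
structure SubseqTransducer (α β Q : Type) where
  init : Q
  step : Q → α → Option (List β × Q)
  final : Q → Option (List β)

/-- The output on the input word when starting in a given state; undefined if there is no
accepting run. -/
def SubseqTransducer.evalFrom {α β Q : Type} (T : SubseqTransducer α β Q) :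
    Q → List α → Option (List β)
  | q, [] => T.final q
  | q, a :: u => (T.step q a).bind fun s => (T.evalFrom s.2 u).map fun v => s.1 ++ v

/-- The partial function computed by the transducer. -/
def SubseqTransducer.eval {α β Q : Type} (T : SubseqTransducer α β Q) (u : List α) :
    Option (List β) :=
  T.evalFrom T.init u

/-- The synchronization `a₁v₁a₂v₂⋯aₙvₙf(p)` of the accepting run on `a₁⋯aₙ` that starts in a given
state; undefined if there is no accepting run. -/
def SubseqTransducer.syncFrom {α β Q : Type} (T : SubseqTransducer α β Q) :
    Q → List α → Option (List (α ⊕ β))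
  | q, [] => (T.final q).map fun v => v.map Sum.inr
  | q, a :: u => (T.step q a).bind fun s =>
      (T.syncFrom s.2 u).map fun w => Sum.inl a :: (s.1.map Sum.inr ++ w)

/-- The synchronization language of the transducer. -/
def SubseqTransducer.syncLanguage {α β Q : Type} (T : SubseqTransducer α β Q) :
    Language (α ⊕ β) :=
  {w | ∃ u : List α, T.syncFrom T.init u = some w}

/-- The transducer is `S`-controlled. -/
def SubseqTransducer.IsControlled {α β Q : Type} (T : SubseqTransducer α β Q)
    (S : Language (α ⊕ β)) : Prop :=
  ∀ w ∈ T.syncLanguage, w ∈ S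

/-- The function computed by the transducer has the same domain as `R` and is contained in `R`. -/
def SubseqTransducer.Uniformizes {α β Q : Type} (T : SubseqTransducer α β Q)
    (R : Set (List α × List β)) : Prop :=
  (∀ u, (∃ v, (u, v) ∈ R) ↔ ∃ v, T.eval u = some v) ∧ ∀ u v, T.eval u = some v → (u, v) ∈ R

/-- `R` has a uniformization by an `S`-controlled subsequential transducer. -/
def HasControlledUniformization {α β : Type} (R : Set (List α × List β))
    (S : Language (α ⊕ β)) : Prop :=
  ∃ (Q : Type) (_ : Finite Q) (T : SubseqTransducer α β Q), T.IsControlled S ∧ T.Uniformizes R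

/-! ### Automatic relations -/

/-- A presentation of an automatic relation: the sizes of its (nonempty) input and output alphabets
and an automaton for a synchronization language contained in `(ΣΓ)*(Σ* + Γ*)`. -/
structure AutomaticPresentation where
  inSize : ℕ
  outSize : ℕ
  inSize_pos : 0 < inSize
  outSize_pos : 0 < outSize
  automaton : FinNFA (Fin inSize ⊕ Fin outSize)
  isSynchronous : ∀ w ∈ automaton.language, w ∈ synchronous (Fin inSize) (Fin outSize)

/-- The automatic relation that is presented. -/
def AutomaticPresentation.relation (P : AutomaticPresentation) :
    Set (List (Fin P.inSize) × List (Fin P.outSize)) :=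
  syncRel P.automaton.language

/-- Writing down a letter of `Fin n ⊕ Fin m`. -/
def letterCode {n m : ℕ} : Fin n ⊕ Fin m → ℕ ⊕ ℕ := Sum.map Fin.val Fin.val

/-- Writing down a presentation: the alphabet sizes and the automaton. -/
def AutomaticPresentation.code (P : AutomaticPresentation) : ℕ × ℕ × NFACode (ℕ ⊕ ℕ) :=
  (P.inSize, P.outSize, P.automaton.code letterCode)

/-! ### Decision problems -/

/-- The problem `Q` on the instances `ι`, which are given to algorithms through their codes, is
decidable: some algorithm halts on the code of every instance with the right answer (its behaviour
on words that are not codes of instances is irrelevant). -/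
def IsDecidableProblem {ι C : Type} [Primcodable C] (code : ι → C) (Q : ι → Prop) : Prop :=
  ∃ f : C →. Bool, Partrec f ∧ ∀ i, ∃ b ∈ f (code i), (b = true ↔ Q i)

/-- An automatic relation together with a regular control language. -/
abbrev ControlInstance : Type := AutomaticPresentation × FinNFA Tape

/-- Writing down an automatic relation and a control language. -/
def ControlInstance.code (I : ControlInstance) : (ℕ × ℕ × NFACode (ℕ ⊕ ℕ)) × NFACode ℕ :=
  (AutomaticPresentation.code I.1, FinNFA.code Tape.toNat I.2)

/-- An automatic relation together with a regular synchronization language over its alphabets. -/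
abbrev SyncInstance : Type :=
  (P : AutomaticPresentation) × FinNFA (Fin P.inSize ⊕ Fin P.outSize)

/-- Writing down an automatic relation and a synchronization language. -/
def SyncInstance.code (I : SyncInstance) :
    (ℕ × ℕ × NFACode (ℕ ⊕ ℕ)) × NFACode (ℕ ⊕ ℕ) :=
  (AutomaticPresentation.code I.1, FinNFA.code letterCode I.2)

/-! A halting problem is reduced to uniformization over a unary input alphabet, with the fixed
control language `1 2* (1 2)*`. A transducer that obeys it and is defined on every `aⁿ` with `n ≥ 1`
may write a block of any length on the first input letter, but must then write exactly one letter
per input letter, with empty final output for `n ≥ 2`. So its outputs for `n ≥ 2` are prefixes of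
one infinite word `V` (`SubseqTransducer.exists_infinite_output`). They have length `n + k`, where
the lag `k` is chosen by the transducer.

An automaton can relate letters of `V` at distance `k` without knowing `k`: the end of the input
marks one position and the end of the output marks the other. An automatic relation can therefore
demand that the last output letter results from a local rule applied to the three letters around the
end of the input. Required for all `n`, this says that `V` is a space-time diagram of a cellular
automaton whose rows of length `k` are written one after another, as on a helix. The case `n = 2`
prescribes the first row: the word `x` between paddings of arbitrary length, so `k` is the row
length.

The light cone of `x` is marked and grows by one cell per step on both sides. The rule is undefined
where the cone touches a separator of rows, so no `V` obeys it forever. The relation waives the rule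
once a halting cell has occurred; hence a uniformizer exists only if the automaton halts on `x`
(`exists_halting_of_isHelix`). Conversely, if it halts, sufficient padding keeps the cone off the
separators until then, and afterwards `V` can be constant, so finitely many states suffice
(`exists_isHelix`, `aheadTransducer`). The equivalence is `hasControlledUniformization_iff`.

The cellular automaton simulates one fixed Turing machine with undecidable halting
(`exists_cellularAutomaton_undecidable`). Only `x` varies with the instance, so the reduction is
computable. The statement for synchronization languages follows by taking the synchronization
language of the same control language. -/

/-! ### A fixed Turing machine with an undecidable halting problem -/

/-- The binary digits of a number can be computed by a primitive recursive function. -/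
theorem primrec_natBits : Primrec Nat.bits := by
  have h : Primrec₂ fun (_ : Unit) (n : ℕ) => Nat.bits n := by
    -- The list `l` holds the values at all smaller numbers, so `l.length` is the current number.
    refine Primrec.nat_strong_rec (fun (_ : Unit) n => Nat.bits n)
      (g := fun _ l => if l.length = 0 then some []
        else (l[l.length / 2]?).map fun t => (l.length % 2 == 1) :: t) ?_ ?_
    · refine Primrec.ite (PrimrecPred.comp (Primrec.eq.comp Primrec.id (Primrec.const 0))
        (Primrec.list_length.comp Primrec.snd)) (Primrec.const _) ?_
      refine Primrec.option_map (Primrec.list_getElem?.comp Primrec.snd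
        (Primrec.nat_div.comp (Primrec.list_length.comp Primrec.snd) (Primrec.const 2))) ?_
      refine Primrec.list_cons.comp (Primrec.beq.comp (Primrec.nat_mod.comp
        (Primrec.list_length.comp (Primrec.snd.comp Primrec.fst)) (Primrec.const 2))
        (Primrec.const 1)) Primrec.snd
    · intro _ n
      rcases Nat.eq_zero_or_pos n with rfl | hn
      · simp
      · have h2 : n / 2 < n := Nat.div_lt_self hn one_lt_two
        have : Nat.bits n = (n % 2 == 1) :: Nat.bits (n / 2) := by
          conv_lhs => rw [← Nat.bit_bodd_div2 n]
          rw [Nat.bits_append_bit, Nat.div2_val, Nat.mod_two_of_bodd]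
          · cases n.bodd <;> rfl
          · intro h0
            rcases Nat.mod_two_eq_zero_or_one n with h | h
            · rw [Nat.div2_val] at h0; omega
            · rw [Nat.mod_two_of_bodd] at h
              cases hb : n.bodd <;> simp_all
        simp [hn.ne', h2, this]
  exact h.comp (Primrec.const ()) Primrec.id

section

open Turing

/-- The encoding of a number on a stack is its binary expansion. -/
theorem trNat_eq_map_bits (n : ℕ) : PartrecToTM2.trNat n =
    n.bits.map fun b => cond b PartrecToTM2.Γ'.bit1 PartrecToTM2.Γ'.bit0 := by
  have key : ∀ p : PosNum, PartrecToTM2.trPosNum p =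
      (p : ℕ).bits.map fun b => cond b PartrecToTM2.Γ'.bit1 PartrecToTM2.Γ'.bit0 := by
    intro p
    induction p with
    | one => simp [PartrecToTM2.trPosNum]
    | bit0 p ih =>
      have : ((PosNum.bit0 p : PosNum) : ℕ) = 2 * (p : ℕ) := by
        rw [PosNum.cast_bit0]; ring
      rw [this, Nat.bit0_bits _ (PosNum.cast_pos p).ne', PartrecToTM2.trPosNum, ih]
      rfl
    | bit1 p ih =>
      have : ((PosNum.bit1 p : PosNum) : ℕ) = 2 * (p : ℕ) + 1 := by
        rw [PosNum.cast_bit1]; ring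
      rw [this, Nat.bit1_bits, PartrecToTM2.trPosNum, ih]
      rfl
  rw [PartrecToTM2.trNat]
  conv_rhs => rw [← Num.to_of_nat n]
  cases (n : Num) with
  | zero => simp [PartrecToTM2.trNum]
  | pos p => exact key p

/-- The restriction of a machine to a set of states that it does not leave. -/
def Turing.TM0.Machine.restrict {Γ Λ : Type} [Inhabited Λ] (M : TM0.Machine Γ Λ) (S : Set Λ)
    [Inhabited S] (h : ∀ {q a q' s}, (q', s) ∈ M q a → q ∈ S → q' ∈ S) : TM0.Machine Γ S :=
  fun q a => (M q a).pmap (fun r hr => (⟨r.1, hr⟩, r.2)) fun _ hr => h hr q.2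

/-- The compiled machine has infinitely many states, but its runs stay in a finite supported set.
This transfers its halting behaviour to a machine whose state type is that set. -/
theorem Turing.TM0.Machine.restrict_respects {Γ Λ : Type} [Inhabited Γ] [Inhabited Λ]
    (M : TM0.Machine Γ Λ) (S : Set Λ) [Inhabited S]
    (h : ∀ {q a q' s}, (q', s) ∈ M q a → q ∈ S → q' ∈ S) :
    StateTransition.Respects (TM0.step (M.restrict S h)) (TM0.step M)
      fun c c' => c' = ⟨c.q, c.Tape⟩ := by
  rintro ⟨q, T⟩ _ rfl
  cases e : M q T.1 with
  | none =>
    have : M.restrict S h q T.1 = none := by simp [Turing.TM0.Machine.restrict, e]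
    simp [TM0.step, e, this]
  | some r =>
    have h' : M.restrict S h q T.1 = some (⟨r.1, h e q.2⟩, r.2) := by
      simp [Turing.TM0.Machine.restrict, e]
    simp only [TM0.step, h', Option.map_some]
    exact ⟨_, rfl, Relation.TransGen.single (by simp [TM0.step, e])⟩

theorem trInit_reverse_cons {K : Type} [DecidableEq K] {Γ : K → Type} (k : K) (a : Γ k)
    (l : List (Γ k)) : TM2to1.trInit k (a :: l).reverse =
      (true, Function.update (fun _ => none) k (some a)) ::
        l.map fun b => (false, Function.update (fun _ => none) k (some b)) := by
  rw [TM2to1.trInit, List.reverse_reverse]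
  rfl

/-- Some Turing machine with finitely many symbols and states has an undecidable halting problem,
already for inputs that are binary expansions of numbers. -/
theorem exists_TM0_halting_undecidable : ∃ (Γ Λ : Type) (_ : Finite Γ) (_ : Inhabited Γ)
    (_ : Finite Λ) (_ : Inhabited Λ) (M : TM0.Machine Γ Λ) (g₀ : Γ) (g : Bool → Γ),
    ¬ ComputablePred fun n : ℕ =>
      (StateTransition.eval (TM0.step M) (TM0.init (g₀ :: n.bits.reverse.map g))).Dom := by
  -- A universal function: one machine for `f` suffices, and the program becomes its input.
  let f : ℕ →. ℕ := fun n => Nat.Partrec.Code.eval (Denumerable.ofNat Nat.Partrec.Code n) 0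
  have hf : Partrec f := Nat.Partrec.Code.eval_part.comp (Computable.ofNat _) (Computable.const 0)
  obtain ⟨c, hc⟩ := ToPartrec.Code.exists_code (Nat.Partrec'.part_iff₁.2 hf)
  have hundec : ¬ ComputablePred fun n : ℕ => (c.eval [n]).Dom := by
    intro h
    refine ComputablePred.halting_problem 0 (ComputablePred.of_eq
      (ComputablePred.computable_iff.2 ?_ :
        ComputablePred fun d : Nat.Partrec.Code => (c.eval [Encodable.encode d]).Dom) fun d => ?_)
    · obtain ⟨t, ht, e⟩ := ComputablePred.computable_iff.1 h
      exact ⟨_, ht.comp Computable.encode, funext fun d => congrFun e (Encodable.encode d)⟩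
    · have := hc (Encodable.encode d ::ᵥ List.Vector.nil)
      simp only [List.Vector.head_cons] at this
      change c.eval [Encodable.encode d] = _ at this
      rw [this]
      simp [f]
  -- Runs begin in the default state, so this instance selects the program `c`.
  let _ : Inhabited PartrecToTM2.Λ' := ⟨PartrecToTM2.trNormal c PartrecToTM2.Cont'.halt⟩
  let M2 : PartrecToTM2.Λ' → TM2.Stmt (fun _ : PartrecToTM2.K' => PartrecToTM2.Γ') PartrecToTM2.Λ'
    (Option PartrecToTM2.Γ') := PartrecToTM2.tr
  let M1 := TM2to1.tr M2
  let M0 := TM1to0.tr M1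
  have s0 := TM1to0.tr_supports M1 (TM2to1.tr_supports M2
    (PartrecToTM2.tr_supports c PartrecToTM2.Cont'.halt))
  let S : Set (TM1to0.Λ' M1) := ↑(TM1to0.trStmts M1
    (TM2to1.trSupp M2 (PartrecToTM2.codeSupp c PartrecToTM2.Cont'.halt)))
  let _ : Inhabited S := ⟨⟨default, s0.1⟩⟩
  let u : PartrecToTM2.Γ' → (PartrecToTM2.K' → Option PartrecToTM2.Γ') :=
    fun a => Function.update (fun _ => none) PartrecToTM2.K'.main (some a)
  have : Finite PartrecToTM2.K' := .of_surjective
    ![PartrecToTM2.K'.main, PartrecToTM2.K'.rev, PartrecToTM2.K'.aux, PartrecToTM2.K'.stack]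
    fun k => by
      cases k
      exacts [⟨0, rfl⟩, ⟨1, rfl⟩, ⟨2, rfl⟩, ⟨3, rfl⟩]
  refine ⟨TM2to1.Γ' PartrecToTM2.K' fun _ => PartrecToTM2.Γ', S,
    inferInstanceAs (Finite (Bool × (PartrecToTM2.K' → Option PartrecToTM2.Γ'))), inferInstance,
    inferInstance, inferInstance, M0.restrict S s0.2, (true, u PartrecToTM2.Γ'.cons),
    fun b => (false, u (cond b PartrecToTM2.Γ'.bit1 PartrecToTM2.Γ'.bit0)), fun h => hundec
      (h.of_eq fun n => ?_)⟩
  -- The tape lists a stack from the bottom up. The terminator `cons` is at the bottom of the main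
  -- stack, hence it comes first, followed by the reversed bits.
  have e1 : PartrecToTM2.trList [n] = (PartrecToTM2.Γ'.cons :: n.bits.reverse.map
      fun b => cond b PartrecToTM2.Γ'.bit1 PartrecToTM2.Γ'.bit0).reverse := by
    simp [trNat_eq_map_bits]
  have e1' := (congrArg (TM2to1.trInit (Γ := fun _ => PartrecToTM2.Γ') PartrecToTM2.K'.main)
    e1).trans (trInit_reverse_cons (Γ := fun _ => PartrecToTM2.Γ') PartrecToTM2.K'.main _ _)
  rw [List.map_map] at e1'
  suffices key : ∀ l, TM2to1.trInit (Γ := fun _ => PartrecToTM2.Γ') PartrecToTM2.K'.main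
      (PartrecToTM2.trList [n]) = l →
      ((StateTransition.eval (TM0.step (M0.restrict S s0.2)) (TM0.init l)).Dom ↔
        (c.eval [n]).Dom) from key _ e1'
  rintro _ rfl
  refine (StateTransition.tr_eval_dom
    (Turing.TM0.Machine.restrict_respects M0 S s0.2) (a₂ := TM0.init (TM2to1.trInit
      (Γ := fun _ => PartrecToTM2.Γ') PartrecToTM2.K'.main
        (PartrecToTM2.trList [n]))) rfl).symm.trans ?_
  change (TM0.eval M0 _).Dom ↔ _
  rw [TM1to0.tr_eval, TM2to1.tr_eval_dom]
  have e2 := PartrecToTM2.tr_eval c [n]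
  have e3 : PartrecToTM2.init c [n] =
      TM2.init PartrecToTM2.K'.main (PartrecToTM2.trList [n]) := by
    simp only [PartrecToTM2.init, TM2.init]
    congr 1
    funext k
    cases k <;> rfl
  rw [e3] at e2
  change (StateTransition.eval (TM2.step PartrecToTM2.tr) _).Dom ↔ _
  rw [e2]
  rfl

end

/-! ### One-dimensional cellular automata -/

/-- One step of the cellular automaton with local rule `δ`. -/
def caStep {A : Type} (δ : A → A → A → A) (c : ℤ → A) : ℤ → A :=
  fun z => δ (c (z - 1)) (c z) (c (z + 1))

/-- The configuration in which the word `x` starts at the origin, with blanks everywhere else. -/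
def caInit {A : Type} (blank : A) (x : List A) : ℤ → A :=
  fun z => if 0 ≤ z then x.getD z.toNat blank else blank

/-- The configuration after `t` steps on the input word `x`. -/
def caOrbit {A : Type} (δ : A → A → A → A) (blank : A) (x : List A) (t : ℕ) : ℤ → A :=
  (caStep δ)^[t] (caInit blank x)

theorem caOrbit_succ {A : Type} (δ : A → A → A → A) (blank : A) (x : List A) (t : ℕ) (z : ℤ) :
    caOrbit δ blank x (t + 1) z = δ (caOrbit δ blank x t (z - 1)) (caOrbit δ blank x t z)
      (caOrbit δ blank x t (z + 1)) := by
  rw [caOrbit, Function.iterate_succ_apply']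
  rfl

/-- Nothing travels faster than light. -/
theorem caOrbit_eq_blank {A : Type} {δ : A → A → A → A} {blank : A}
    (hδ : δ blank blank blank = blank) (x : List A) (t : ℕ) (z : ℤ)
    (hz : z < -t ∨ x.length + t ≤ z) : caOrbit δ blank x t z = blank := by
  induction t generalizing z with
  | zero =>
    simp only [caOrbit, Function.iterate_zero, id, caInit]
    split_ifs with h
    · exact List.getD_eq_default _ _ (by omega)
    · rfl
  | succ t ih =>
    rw [caOrbit_succ, ih _ (by omega), ih _ (by omega), ih _ (by omega), hδ]

/-! ### Simulation of Turing machines by cellular automata -/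

section TuringMachine

open Turing

variable {Γ Λ : Type} [Inhabited Λ]

/-- The local rule of the cellular automaton that simulates a Turing machine. A cell holds a symbol
and the state of the machine if the head is there. -/
def tmRule (M : TM0.Machine Γ Λ) (p q r : Γ × Option Λ) : Γ × Option Λ :=
  match q.2 with
  | some s =>
    match M s q.1 with
    | none => q
    | some (_, .move _) => (q.1, none)
    | some (s', .write a) => (a, some s')
  | none =>
    match p.2.bind fun s => M s p.1 with
    | some (s', .move .right) => (q.1, some s')
    | _ =>
      match r.2.bind fun s => M s r.1 with
      | some (s', .move .left) => (q.1, some s')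
      | _ => q

/-- A cell at which the machine has halted. -/
def tmHalted (M : TM0.Machine Γ Λ) (q : Γ × Option Λ) : Prop := ∃ s, q.2 = some s ∧ M s q.1 = none

variable [Inhabited Γ]

/-- The cell contents that describe a configuration with the head at position `p`. -/
def tmCells (c : TM0.Cfg Γ Λ) (p : ℤ) : ℤ → Γ × Option Λ :=
  fun z => (c.Tape.nth (z - p), if z = p then some c.q else none)

/-- The tape of a configuration is indexed relative to the head while the cells are fixed, so a head
move shifts `p` and leaves the symbols in place. A halted configuration stays as it is, which is the
role of `getD c`. -/
theorem caStep_tmCells (M : TM0.Machine Γ Λ) (c : TM0.Cfg Γ Λ) (p : ℤ) :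
    ∃ p', caStep (tmRule M) (tmCells c p) = tmCells ((TM0.step M c).getD c) p' := by
  obtain ⟨q, T⟩ := c
  have h0 : T.nth 0 = T.head := Tape.nth_zero T
  -- Only the head cell and its two neighbours can react to the head.
  have cases4 : ∀ z p : ℤ, z = p ∨ (z ≠ p ∧ z - 1 = p ∧ z + 1 ≠ p) ∨
      (z ≠ p ∧ z - 1 ≠ p ∧ z + 1 = p) ∨ (z ≠ p ∧ z - 1 ≠ p ∧ z + 1 ≠ p) := by
    intro z p
    omega
  rcases e : M q T.head with _ | ⟨q', d | a⟩
  · refine ⟨p, funext fun z => ?_⟩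
    simp only [caStep, tmCells, tmRule, TM0.step, e, Option.map_none, Option.getD_none]
    rcases cases4 z p with h | ⟨h, h1, h2⟩ | ⟨h, h1, h2⟩ | ⟨h, h1, h2⟩
    · simp [h, h0, e]
    all_goals simp [h, h1, h2, h0, e]
  · cases d with
    | left =>
      refine ⟨p - 1, funext fun z => ?_⟩
      simp only [caStep, tmCells, tmRule, TM0.step, e, Option.map_some, Option.getD_some,
        Tape.move_left_nth]
      rw [show z - (p - 1) - 1 = z - p by ring]
      rcases cases4 z p with h | ⟨h, h1, h2⟩ | ⟨h, h1, h2⟩ | ⟨h, h1, h2⟩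
      · have h3 : p ≠ p - 1 := by omega
        simp [h, h0, e, h3]
      · have h3 : z ≠ p - 1 := by omega
        simp [h, h1, h2, h3, h0, e]
      · have h3 : z = p - 1 := by omega
        simp only [h2, sub_self, h0, if_neg h, if_neg h1, if_pos h3, if_true, Option.bind_some, e,
          Option.bind_none]
      · have h3 : z ≠ p - 1 := by omega
        simp [h, h1, h2, h3]
    | right =>
      refine ⟨p + 1, funext fun z => ?_⟩
      simp only [caStep, tmCells, tmRule, TM0.step, e, Option.map_some, Option.getD_some,
        Tape.move_right_nth]
      rw [show z - (p + 1) + 1 = z - p by ring]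
      rcases cases4 z p with h | ⟨h, h1, h2⟩ | ⟨h, h1, h2⟩ | ⟨h, h1, h2⟩
      · simp [h, h0, e]
      · have h3 : z = p + 1 := by omega
        simp only [h1, sub_self, h0, if_neg h, if_pos h3, if_true, Option.bind_some, e]
      · have h3 : z ≠ p + 1 := by omega
        simp [h, h1, h2, h3, h0, e]
      · have h3 : z ≠ p + 1 := by omega
        simp [h, h1, h2, h3]
  · refine ⟨p, funext fun z => ?_⟩
    simp only [caStep, tmCells, tmRule, TM0.step, e, Option.map_some, Option.getD_some,
      Tape.write_nth]
    rcases cases4 z p with h | ⟨h, h1, h2⟩ | ⟨h, h1, h2⟩ | ⟨h, h1, h2⟩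
    · simp [h, h0, e]
    all_goals
      have h4 : z - p ≠ 0 := by omega
      simp [h, h1, h2, h4, h0, e]

theorem caInit_eq_tmCells (a : Γ) (l : List Γ) :
    caInit ((default : Γ), (none : Option Λ)) ((a, some default) :: l.map fun g => (g, none)) =
      tmCells (TM0.init (a :: l)) 0 := by
  funext z
  simp only [caInit, tmCells, TM0.init, sub_zero]
  rcases lt_trichotomy z 0 with h | rfl | h
  · obtain ⟨n, rfl⟩ := Int.eq_negSucc_of_lt_zero h
    simp only [if_neg (not_le.2 h), if_neg h.ne]
    refine Prod.ext ?_ rfl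
    change _ = (Tape.mk₁ (a :: l)).left.nth n
    simp [Tape.mk₁, Tape.mk₂, Tape.mk', ListBlank.nth_mk, List.getI]
  · refine Prod.ext ?_ (by simp)
    simp [Tape.mk₁, Tape.mk₂]
  · obtain ⟨n, rfl⟩ : ∃ n : ℕ, z = (n + 1 : ℕ) := ⟨(z - 1).toNat, by omega⟩
    have e : (Tape.mk₁ (a :: l)).nth ((n + 1 : ℕ) : ℤ) = l.getD n default := by
      rw [Tape.mk₁, Tape.mk₂, Tape.mk'_nth_nat, ListBlank.nth_mk, List.getI_cons_succ,
        List.getD_default_eq_getI]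
    rw [e, if_pos (by omega), if_neg h.ne', Int.toNat_natCast, List.getD_cons_succ]
    rw [List.getD_eq_getElem?_getD, List.getD_eq_getElem?_getD, List.getElem?_map]
    cases l[n]? <;> rfl

/-- Freezing the machine when it halts makes its run total. Each configuration of the cellular
automaton then has exactly one head cell, and that cell is halted exactly when the machine has no
next step. -/
theorem exists_tmHalted_caOrbit_iff (M : TM0.Machine Γ Λ) (a : Γ) (l : List Γ) :
    (∃ t z, tmHalted M (caOrbit (tmRule M) (default, none)
      ((a, some default) :: l.map fun g => (g, none)) t z)) ↔
      (StateTransition.eval (TM0.step M) (TM0.init (a :: l))).Dom := by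
  set x : List (Γ × Option Λ) := (a, some default) :: l.map fun g => (g, none)
  let run : ℕ → TM0.Cfg Γ Λ := fun t => (fun c => (TM0.step M c).getD c)^[t] (TM0.init (a :: l))
  have hrun : ∀ t, run (t + 1) = (TM0.step M (run t)).getD (run t) := fun t =>
    Function.iterate_succ_apply' _ _ _
  have hcells : ∀ t, ∃ p, caOrbit (tmRule M) (default, none) x t = tmCells (run t) p := by
    intro t
    induction t with
    | zero => exact ⟨0, caInit_eq_tmCells a l⟩
    | succ t ih =>
      obtain ⟨p, hp⟩ := ih
      obtain ⟨p', hp'⟩ := caStep_tmCells M (run t) p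
      refine ⟨p', ?_⟩
      rw [hrun, ← hp', ← hp, caOrbit, Function.iterate_succ_apply']
      rfl
  have hstep : ∀ c : TM0.Cfg Γ Λ, TM0.step M c = none ↔ M c.q c.Tape.head = none := fun c => by
    simp [TM0.step]
  have hhalt : (∃ t z, tmHalted M (caOrbit (tmRule M) (default, none) x t z)) ↔
      ∃ t, TM0.step M (run t) = none := by
    refine exists_congr fun t => ?_
    obtain ⟨p, hp⟩ := hcells t
    rw [hp, hstep]
    constructor
    · rintro ⟨z, s, h1, h2⟩
      simp only [tmCells, Option.ite_none_right_eq_some, Option.some.injEq] at h1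
      obtain ⟨rfl, rfl⟩ := h1
      simpa [tmCells, Tape.nth_zero] using h2
    · intro h
      exact ⟨p, (run t).q, by simp [tmCells], by simpa [tmCells, Tape.nth_zero] using h⟩
  rw [hhalt]
  constructor
  · rintro ⟨t, ht⟩
    have hreach : StateTransition.Reaches (TM0.step M) (TM0.init (a :: l)) (run t) := by
      clear ht
      induction t with
      | zero => exact Relation.ReflTransGen.refl
      | succ t ih =>
        rw [hrun]
        cases e : TM0.step M (run t) with
        | none => exact ih
        | some c => exact ih.tail e
    exact Part.dom_iff_mem.2 ⟨_, StateTransition.mem_eval.2 ⟨hreach, ht⟩⟩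
  · intro h
    obtain ⟨c, hc⟩ := Part.dom_iff_mem.1 h
    obtain ⟨h1, h2⟩ := StateTransition.mem_eval.1 hc
    have : ∃ t, run t = c := by
      clear h2 hc
      induction h1 with
      | refl => exact ⟨0, rfl⟩
      | tail _ hs ih =>
        obtain ⟨t, rfl⟩ := ih
        exact ⟨t + 1, by rw [hrun, Option.mem_def.1 hs]; rfl⟩
    obtain ⟨t, rfl⟩ := this
    exact ⟨t, h2⟩

end TuringMachine

/-- For some cellular automaton it is undecidable whether a halting cell occurs in the run on a
given input, already for inputs that are binary expansions of numbers. -/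
theorem exists_cellularAutomaton_undecidable : ∃ (A : Type) (_ : Finite A) (blank : A)
    (δ : A → A → A → A) (H : A → Prop) (a₀ : A) (g : Bool → A),
    δ blank blank blank = blank ∧ ¬ H blank ∧ ¬ ComputablePred fun n : ℕ =>
      ∃ t z, H (caOrbit δ blank (a₀ :: n.bits.reverse.map g) t z) := by
  obtain ⟨Γ, Λ, _, _, _, _, M, g₀, g, h⟩ := exists_TM0_halting_undecidable
  refine ⟨Γ × Option Λ, inferInstance, (default, none), tmRule M, tmHalted M, (g₀, some default),
    fun b => (g b, none), rfl, by simp [tmHalted], fun hc => h (hc.of_eq fun n => ?_)⟩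
  rw [← exists_tmHalted_caOrbit_iff]
  simp only [List.map_map, Function.comp_def]

/-! ### Helical space-time diagrams -/

/-- A letter of a space-time diagram that is written row after row as one word: the separator of
rows, a cell that no signal from the input can have reached, or a cell of the light cone. -/
inductive Cell (A : Type)
  | wall
  | out
  | inn (a : A)

instance Cell.finite {A : Type} [Finite A] : Finite (Cell A) :=
  .of_surjective (fun o : Option (Option A) =>
    match o with
    | none => Cell.wall
    | some none => Cell.out
    | some (some a) => Cell.inn a) fun c => by
      cases c with
      | wall => exact ⟨none, rfl⟩
      | out => exact ⟨some none, rfl⟩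
      | inn a => exact ⟨some (some a), rfl⟩

/-- Whether the cell belongs to the light cone. -/
def Cell.isInn {A : Type} : Cell A → Bool
  | inn _ => true
  | _ => false

/-- The state of the cellular automaton at the cell. -/
def Cell.content {A : Type} (blank : A) : Cell A → A
  | inn a => a
  | _ => blank

/-- The cell contains a halting state. -/
def Cell.Halted {A : Type} (H : A → Prop) : Cell A → Prop
  | inn a => H a
  | _ => False

/-- The letter below `q` if its neighbours are `p` and `r`. The light cone must not touch a
separator. -/
def cellRule {A : Type} (δ : A → A → A → A) (blank : A) (p q r : Cell A) : Option (Cell A) :=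
  match q with
  | .wall => if p.isInn || r.isInn then none else some .wall
  | q => some (if p.isInn || q.isInn || r.isInn
      then .inn (δ (p.content blank) (q.content blank) (r.content blank)) else .out)

theorem cellRule_wall {A : Type} {δ : A → A → A → A} {blank : A} {p r c : Cell A}
    (h : cellRule δ blank p .wall r = some c) : c = .wall ∧ p.isInn = false ∧ r.isInn = false := by
  cases hp : p.isInn <;> cases hr : r.isInn <;> simp_all [cellRule]

/-- The first row and the first two letters of the second row. -/
def firstRow {A : Type} (x : List A) (l r : ℕ) : List (Cell A) :=
  [.wall, .out, .out] ++ List.replicate l .out ++ x.map .inn ++ List.replicate r .out ++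
    [.wall, .out]

/-- The length of the rows. -/
def rowLength {A : Type} (x : List A) (l r : ℕ) : ℕ := 3 + l + x.length + r

/-- The cell of the space-time diagram at time `t` and position `s` of the row. -/
def rowCell {A : Type} (δ : A → A → A → A) (blank : A) (x : List A) (l r t s : ℕ) : Cell A :=
  if s = 0 ∨ s = rowLength x l r then .wall
  else if 3 + l ≤ s + t ∧ s < 3 + l + x.length + t then .inn (caOrbit δ blank x t (s - 3 - l))
  else .out

section

variable {A : Type} {δ : A → A → A → A} {blank : A} {x : List A} {l r t s : ℕ}

/-- The two bounds on `t` keep the cone strictly between the separators, so the first case of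
`rowCell` never hides a cell of the cone. -/
theorem isInn_rowCell (hl : t ≤ l + 2) (hr : t ≤ r) :
    (rowCell δ blank x l r t s).isInn = decide (3 + l ≤ s + t ∧ s < 3 + l + x.length + t) := by
  unfold rowCell rowLength
  split_ifs with h1 h2
  · have : ¬ (3 + l ≤ s + t ∧ s < 3 + l + x.length + t) := by omega
    simp [Cell.isInn, this]
  · simp [Cell.isInn, h2]
  · simp [Cell.isInn, h2]

/-- Letters outside the cone are read as blanks, which is correct because nothing travels faster
than light. -/
theorem content_rowCell (hδ : δ blank blank blank = blank) (hl : t ≤ l + 2) (hr : t ≤ r) :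
    (rowCell δ blank x l r t s).content blank = caOrbit δ blank x t (s - 3 - l) := by
  unfold rowCell rowLength
  split_ifs with h1 h2
  · exact (caOrbit_eq_blank hδ x t _ (by omega)).symm
  · rfl
  · exact (caOrbit_eq_blank hδ x t _ (by omega)).symm

theorem rowCell_ne_wall (h0 : s ≠ 0) (hs : s < rowLength x l r) :
    rowCell δ blank x l r t s ≠ .wall := by
  unfold rowCell
  rw [if_neg (by omega)]
  split_ifs <;> simp

/-- A cell is in the cone at time `t + 1` exactly when it or a neighbour is in the cone at time `t`.
This uses that `x` is nonempty: an empty cone would not grow. -/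
theorem cellRule_rowCell (hδ : δ blank blank blank = blank) (hx : x ≠ []) (hl : t ≤ l + 2)
    (hr : t ≤ r) (hs : s + 1 < rowLength x l r) :
    cellRule δ blank (rowCell δ blank x l r t s) (rowCell δ blank x l r t (s + 1))
      (rowCell δ blank x l r t (s + 2)) = some (rowCell δ blank x l r (t + 1) (s + 1)) := by
  have hx' := List.length_pos_iff.2 hx
  have hq : ∀ p q r' : Cell A, q ≠ .wall → cellRule δ blank p q r' =
      some (if p.isInn || q.isInn || r'.isInn
        then .inn (δ (p.content blank) (q.content blank) (r'.content blank)) else .out) := by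
    intro p q r' h
    cases q <;> simp_all [cellRule]
  rw [hq _ _ _ (rowCell_ne_wall (by omega) hs), isInn_rowCell hl hr, isInn_rowCell hl hr,
    isInn_rowCell hl hr, content_rowCell hδ hl hr, content_rowCell hδ hl hr,
    content_rowCell hδ hl hr]
  conv_rhs => rw [rowCell, if_neg (by omega), caOrbit_succ]
  congr 1
  push_cast
  rw [show (s : ℤ) + 1 - 3 - l - 1 = s - 3 - l by ring,
    show (s : ℤ) + 1 - 3 - l + 1 = s + 2 - 3 - l by ring]
  refine if_congr ?_ rfl rfl
  simp only [Bool.or_eq_true, decide_eq_true_eq]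
  omega

theorem getElem?_firstRow (δ : A → A → A → A) (blank : A) (x : List A) (l r s : ℕ) :
    (firstRow x l r)[s]? = if s < rowLength x l r then some (rowCell δ blank x l r 0 s)
      else if s = rowLength x l r then some .wall
      else if s = rowLength x l r + 1 then some .out else none := by
  have e3 : ([.wall, .out, .out] : List (Cell A)).length = 3 := rfl
  have e2 : ([.wall, .out] : List (Cell A)).length = 2 := rfl
  simp only [firstRow, rowCell]
  generalize hk : rowLength x l r = k
  rw [rowLength] at hk
  simp only [List.getElem?_append, List.length_append, List.length_replicate, List.length_map, e3,
    hk, add_zero]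
  by_cases h1 : s < 3
  · have h5 : s < k := by omega
    have h6 : s < 3 + l + x.length := by omega
    have h7 : s < 3 + l := by omega
    have h8 : s ≠ k := by omega
    have h9 : ¬ (3 + l ≤ s) := by omega
    simp only [h5, h6, h7, h8, h9, h1, if_true, if_false, or_false, false_and]
    interval_cases s <;> simp
  · have h0 : s ≠ 0 := by omega
    by_cases h2 : s < 3 + l
    · have h5 : s < k := by omega
      have h6 : s < 3 + l + x.length := by omega
      have h8 : s ≠ k := by omega
      have h9 : ¬ (3 + l ≤ s) := by omega
      simp only [h5, h6, h2, h8, h9, h1, h0, if_true, if_false, or_false, false_and]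
      rw [List.getElem?_replicate, if_pos (by omega)]
    · by_cases h3 : s < 3 + l + x.length
      · have h5 : s < k := by omega
        have h8 : s ≠ k := by omega
        have h9 : 3 + l ≤ s := by omega
        simp only [h5, h2, h3, h8, h9, h0, if_true, if_false, or_false, and_self]
        rw [List.getElem?_map, List.getElem?_eq_getElem (by omega)]
        have : ((s : ℤ) - 3 - l).toNat = s - (3 + l) := by omega
        simp only [caOrbit, Function.iterate_zero, id, caInit, this, Option.map_some]
        rw [if_pos (by omega), List.getD_eq_getElem]
      · by_cases h4 : s < k
        · have h8 : s ≠ k := by omega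
          simp only [h4, h3, h8, h0, if_true, if_false, or_false, and_false]
          rw [List.getElem?_replicate, if_pos (by omega)]
        · simp only [h4, if_false]
          split_ifs with h5 h6
          · subst h5; simp
          · subst h6; simp
          · exact List.getElem?_eq_none (by rw [e2]; omega)

end

/-! ### Helices and halting -/

/-- The conditions that a transducer has to guarantee for its (infinite) output. -/
structure IsHelix {A : Type} (δ : A → A → A → A) (blank : A) (H : A → Prop) (x : List A) (k : ℕ)
    (V : ℕ → Cell A) : Prop where
  first : ∃ l r, (List.range (k + 2)).map V = firstRow x l r
  rule : ∀ m, 1 ≤ m → (∃ i < m, (V i).Halted H) ∨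
    cellRule δ blank (V m) (V (m + 1)) (V (m + 2)) = some (V (m + 1 + k))

/-- Up to the first halted letter, `V` has to agree with the true space-time diagram, so that letter
is a genuine halting cell. Without a halted letter the agreement would persist until the growing
cone hits a separator, where the rule is undefined. -/
theorem exists_halting_of_isHelix {A : Type} {δ : A → A → A → A} {blank : A} {H : A → Prop}
    {x : List A} {k : ℕ} {V : ℕ → Cell A} (hδ : δ blank blank blank = blank) (hx : x ≠ [])
    (hV : IsHelix δ blank H x k V) : ∃ t z, H (caOrbit δ blank x t z) := by
  obtain ⟨l, r, hfirst⟩ := hV.first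
  have hk : k = rowLength x l r := by
    have := congrArg List.length hfirst
    simp [firstRow] at this
    unfold rowLength
    omega
  have hk3 : 3 ≤ k := by rw [hk, rowLength]; omega
  have hinit : ∀ i < k + 2, some (V i) = (firstRow x l r)[i]? := by
    intro i hi
    rw [← hfirst]
    simp [hi]
  have hrow0 : ∀ s < k, V s = rowCell δ blank x l r 0 s := fun s hs => by
    have := hinit s (by omega)
    rw [getElem?_firstRow δ blank, if_pos (hk ▸ hs)] at this
    exact Option.some.inj this
  have hwall : V k = .wall := by
    have := hinit k (by omega)
    rw [getElem?_firstRow δ blank, if_neg (by omega), if_pos hk] at this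
    exact Option.some.inj this
  have hout : V (k + 1) = .out := by
    have := hinit (k + 1) (by omega)
    rw [getElem?_firstRow δ blank, if_neg (by omega), if_neg (by omega), if_pos (by omega)] at this
    exact Option.some.inj this
  -- Here `j` is the position of the middle letter to which the rule is applied. The row bounds on
  -- `t` are carried along because they are what keeps the next row correct.
  have key : ∀ N, (∀ j, 2 ≤ j → j ≤ N + 1 →
      cellRule δ blank (V (j - 1)) (V j) (V (j + 1)) = some (V (j + k))) → ∀ t, t * k ≤ N + 1 →
      (∀ s ≤ k, V (t * k + s) = rowCell δ blank x l r t s) ∧ t ≤ l + 2 ∧ t ≤ r := by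
    intro N hN t
    induction t with
    | zero =>
      intro _
      refine ⟨fun s hs => ?_, by omega, by omega⟩
      rw [zero_mul, zero_add]
      rcases hs.lt_or_eq with h | rfl
      · exact hrow0 s h
      · rw [hwall, rowCell, if_pos (Or.inr hk)]
    | succ t ih =>
      intro ht
      have hmul : (t + 1) * k = t * k + k := by ring
      obtain ⟨hrow, hl, hr⟩ := ih (by omega)
      have hnew : ∀ s, 1 ≤ s → s < k → V ((t + 1) * k + s) = rowCell δ blank x l r (t + 1) s := by
        intro s h1 h2
        obtain ⟨s, rfl⟩ : ∃ s', s = s' + 1 := ⟨s - 1, by omega⟩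
        -- The rule is only imposed from `j = 2` on; the letter below position 1 is the final `out`
        -- of `firstRow`.
        by_cases h3 : t = 0 ∧ s = 0
        · obtain ⟨rfl, rfl⟩ := h3
          rw [show (0 + 1) * k + (0 + 1) = k + 1 by ring, hout, rowCell, if_neg (by omega),
            if_neg (by omega)]
        · have h4 : 2 ≤ t * k + (s + 1) := by
            rcases Nat.eq_zero_or_pos t with rfl | h
            · omega
            · have := Nat.le_mul_of_pos_left k h
              omega
          have := hN _ h4 (by omega)
          rw [show t * k + (s + 1) - 1 = t * k + s by omega, hrow s (by omega),
            hrow (s + 1) (by omega), show t * k + (s + 1) + 1 = t * k + (s + 2) by ring,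
            hrow (s + 2) (by omega), cellRule_rowCell hδ hx hl hr (hk ▸ h2)] at this
          rw [show (t + 1) * k + (s + 1) = t * k + (s + 1) + k by ring]
          exact (Option.some.inj this).symm
      have hw : V ((t + 1) * k) = .wall := by
        rw [hmul, hrow k le_rfl, rowCell, if_pos (Or.inr hk)]
      -- The neighbours of this separator are the last inner cell of row `t` and the first inner
      -- cell of row `t + 1`. Both must lie outside the cone, which bounds `t + 1` by the two
      -- paddings.
      have h5 := hN ((t + 1) * k) (by omega) ht
      rw [hw] at h5
      obtain ⟨h6, h7, h8⟩ := cellRule_wall h5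
      rw [show (t + 1) * k - 1 = t * k + (k - 1) by omega, hrow (k - 1) (by omega),
        isInn_rowCell hl hr, decide_eq_false_iff_not] at h7
      have hr' : t + 1 ≤ r := by
        have : k = 3 + l + x.length + r := hk
        have := List.length_pos_iff.2 hx
        omega
      have hl' : t + 1 ≤ l + 2 := by
        rw [hnew 1 le_rfl (by omega), rowCell, if_neg (by omega)] at h8
        by_contra hcon
        rw [if_pos (by omega)] at h8
        simp [Cell.isInn] at h8
      refine ⟨fun s hs => ?_, hl', hr'⟩
      rcases Nat.eq_zero_or_pos s with rfl | h
      · rw [add_zero, hw, rowCell, if_pos (Or.inl rfl)]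
      · rcases hs.lt_or_eq with h' | rfl
        · exact hnew s h h'
        · rw [h6, rowCell, if_pos (Or.inr hk)]
  have hcheck : ∀ j, 2 ≤ j → (∀ i, i + 1 < j → ¬ (V i).Halted H) →
      cellRule δ blank (V (j - 1)) (V j) (V (j + 1)) = some (V (j + k)) := by
    intro j hj hno
    obtain ⟨m, rfl⟩ : ∃ m, j = m + 1 := ⟨j - 1, by omega⟩
    rcases hV.rule m (by omega) with ⟨i, hi, h⟩ | h
    · exact absurd h (hno i (by omega))
    · exact h
  by_cases hex : ∃ i, (V i).Halted H
  · classical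
    have h1 := Nat.find_spec hex
    set N := Nat.find hex with hN
    -- Minimality of `N` makes the rule available for all `j ≤ N + 1`, which covers the row
    -- containing position `N`.
    have h2 := key N (fun j h2 h3 => hcheck j h2 fun i hi => Nat.find_min hex (by omega)) (N / k)
      ((Nat.div_mul_le_self N k).trans (by omega))
    have h3 := h2.1 (N % k) (Nat.mod_lt _ (by omega)).le
    rw [Nat.div_add_mod'] at h3
    rw [h3, rowCell] at h1
    split_ifs at h1
    · exact h1.elim
    · exact ⟨_, _, h1⟩
    · exact h1.elim
  -- At time `l + 3` the cone would have passed the left separator.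
  · have h2 := key ((l + 3) * k) (fun j h2 h3 => hcheck j h2 fun i hi h => hex ⟨i, h⟩) (l + 3)
      (by omega)
    omega

/-- Paddings longer than the halting time keep the cone inside the rows for as long as the rule is
in force. Only finitely many rows matter, and the rest is filled with a constant letter. -/
theorem exists_isHelix {A : Type} {δ : A → A → A → A} {blank : A} {H : A → Prop} {x : List A}
    (hδ : δ blank blank blank = blank) (hH : ¬ H blank) (hx : x ≠ [])
    (h : ∃ t z, H (caOrbit δ blank x t z)) :
    ∃ k V, (∃ N, ∀ i, N ≤ i → V i = Cell.wall) ∧ IsHelix δ blank H x k V := by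
  obtain ⟨t₀, z₀, h⟩ := h
  -- Windows that precede the release reach row `t₀ + 1` and results reach row `t₀ + 2`; `t₀ + 4`
  -- rows and as much padding leave room for both.
  set l := t₀ + 4 with hl
  set k := rowLength x l l with hk
  have hk' : k = 3 + l + x.length + l := hk
  have hz : - (t₀ : ℤ) ≤ z₀ ∧ z₀ < x.length + t₀ := by
    by_contra hcon
    rw [caOrbit_eq_blank hδ x t₀ z₀ (by omega)] at h
    exact hH h
  obtain ⟨s₀, hs₀⟩ : ∃ s₀ : ℕ, (s₀ : ℤ) = z₀ + 3 + l := ⟨(z₀ + 3 + l).toNat, by omega⟩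
  set V : ℕ → Cell A := fun i =>
    if i < (t₀ + 4) * k then rowCell δ blank x l l (i / k) (i % k) else .wall with hV
  have hrow : ∀ t s, t < t₀ + 4 → s < k → V (t * k + s) = rowCell δ blank x l l t s := by
    intro t s ht hs
    have h1 : (t + 1) * k ≤ (t₀ + 4) * k := Nat.mul_le_mul_right k (by omega)
    have h2 : (t + 1) * k = t * k + k := by ring
    simp only [hV]
    rw [if_pos (by omega), show t * k + s = k * t + s by ring, Nat.mul_add_div (by omega),
      Nat.mul_add_mod, Nat.div_eq_of_lt hs, Nat.mod_eq_of_lt hs, add_zero]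
  have hrow' : ∀ t s, t + 1 < t₀ + 4 → s ≤ k → V (t * k + s) = rowCell δ blank x l l t s := by
    intro t s ht hs
    rcases hs.lt_or_eq with h1 | rfl
    · exact hrow t s (by omega) h1
    · have := hrow (t + 1) 0 ht (by omega)
      rw [add_zero, add_mul, one_mul] at this
      rw [this, rowCell, rowCell, if_pos (Or.inl rfl), if_pos (Or.inr hk)]
  refine ⟨k, V, ⟨(t₀ + 4) * k, fun i hi => if_neg (by omega)⟩, ⟨l, l, ?_⟩, fun m hm => ?_⟩
  · refine List.ext_getElem? fun i => ?_
    rw [getElem?_firstRow δ blank]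
    split_ifs with h1 h2 h3
    · have := hrow 0 i (by omega) h1
      rw [zero_mul, zero_add] at this
      simp [this, show i < k + 2 by omega]
    · have := hrow' 0 i (by omega) (by omega)
      rw [zero_mul, zero_add, rowCell, if_pos (Or.inr h2)] at this
      simp [this, show i < k + 2 by omega]
    · have := hrow 1 1 (by omega) (by omega)
      rw [one_mul, rowCell, if_neg (by omega), if_neg (by omega)] at this
      rw [h3, ← hk]
      simp [this]
    · simp
      omega
  -- Beyond the halting cell at time `t₀` and position `s₀` the rule is waived.
  · by_cases hmi : t₀ * k + s₀ < m
    · refine Or.inl ⟨t₀ * k + s₀, hmi, ?_⟩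
      rw [hrow t₀ s₀ (by omega) (by omega), rowCell, if_neg (by omega), if_pos (by omega)]
      rw [show (s₀ : ℤ) - 3 - l = z₀ by omega]
      exact h
    · right
      have hm1 : m + 1 = (m + 1) / k * k + (m + 1) % k := (Nat.div_add_mod' _ _).symm
      set t := (m + 1) / k
      have hsk : (m + 1) % k < k := Nat.mod_lt _ (by omega)
      set s := (m + 1) % k
      have ht : t ≤ t₀ + 1 := by
        by_contra hcon
        have h1 : (t₀ + 2) * k ≤ t * k := Nat.mul_le_mul_right k (by omega)
        have h2 : (t₀ + 2) * k = t₀ * k + 2 * k := by ring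
        omega
      rw [show m + 1 + k = (t + 1) * k + s by rw [hm1]; ring, hrow (t + 1) s (by omega) hsk,
        show m + 2 = t * k + (s + 1) by omega, hrow' t (s + 1) (by omega) (by omega), hm1,
        hrow t s (by omega) hsk]
      rcases Nat.eq_zero_or_pos s with hs | hs
      -- The middle letter is a separator, whose left neighbour belongs to the previous row.
      · obtain ⟨t', ht'⟩ : ∃ t', t = t' + 1 := by
          rcases Nat.eq_zero_or_pos t with h1 | h1
          · rw [h1, hs] at hm1
            omega
          · exact ⟨t - 1, by omega⟩
        have h2 : m = t' * k + (k - 1) := by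
          have : (t' + 1) * k = t' * k + k := by ring
          rw [ht', this] at hm1
          omega
        rw [h2, hrow t' (k - 1) (by omega) (by omega), hs]
        have h3 : ∀ t, rowCell δ blank x l l t 0 = .wall := fun t => by
          rw [rowCell, if_pos (Or.inl rfl)]
        rw [h3, h3, cellRule, isInn_rowCell (by omega) (by omega),
          isInn_rowCell (by omega) (by omega), if_neg]
        simp only [Bool.or_eq_true, decide_eq_true_eq]
        omega
      · obtain ⟨s', hs'⟩ : ∃ s', s = s' + 1 := ⟨s - 1, by omega⟩
        rw [show m = t * k + s' by omega, hrow t s' (by omega) (by omega), hs']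
        exact cellRule_rowCell hδ hx (by omega) (by omega) (by omega)

/-! ### Runs of automata -/

/-- Acceptance of a word from a given state by an automaton with transition relation `Δ` and set
of final states `F`. -/
inductive Accepts {σ α : Type} (Δ : σ → α → σ → Prop) (F : σ → Prop) : σ → List α → Prop
  | nil {p} : F p → Accepts Δ F p []
  | cons {p a q w} : Δ p a q → Accepts Δ F q w → Accepts Δ F p (a :: w)

theorem accepts_nil_iff {σ α : Type} {Δ : σ → α → σ → Prop} {F : σ → Prop} {p : σ} :
    Accepts Δ F p [] ↔ F p :=
  ⟨fun h => by cases h; assumption, .nil⟩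

theorem accepts_cons_iff {σ α : Type} {Δ : σ → α → σ → Prop} {F : σ → Prop} {p : σ} {a : α}
    {w : List α} : Accepts Δ F p (a :: w) ↔ ∃ q, Δ p a q ∧ Accepts Δ F q w :=
  ⟨fun h => by cases h with | cons h1 h2 => exact ⟨_, h1, h2⟩, fun ⟨_, h1, h2⟩ => .cons h1 h2⟩

/-- Since every transition of `Δ'` comes from one of `Δ`, numbers that name no state cannot be
entered. This permits working with inductive state types instead of numbers. -/
theorem accepts_map_iff {σ τ α : Type} {Δ : σ → α → σ → Prop} {F : σ → Prop}
    {Δ' : τ → α → τ → Prop} {F' : τ → Prop} {f : σ → τ} (hf : Function.Injective f)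
    (hΔ : ∀ p' a q', Δ' p' a q' ↔ ∃ p q, f p = p' ∧ f q = q' ∧ Δ p a q)
    (hF : ∀ p', F' p' ↔ ∃ p, f p = p' ∧ F p) (p : σ) (w : List α) :
    Accepts Δ' F' (f p) w ↔ Accepts Δ F p w := by
  induction w generalizing p with
  | nil =>
    rw [accepts_nil_iff, accepts_nil_iff, hF]
    exact ⟨fun ⟨q, h, hq⟩ => hf h ▸ hq, fun h => ⟨p, rfl, h⟩⟩
  | cons a w ih =>
    simp only [accepts_cons_iff, hΔ]
    constructor
    · rintro ⟨_, ⟨p', q, h1, rfl, h2⟩, h3⟩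
      exact ⟨q, hf h1 ▸ h2, (ih q).1 h3⟩
    · rintro ⟨q, h1, h2⟩
      exact ⟨_, ⟨p, q, rfl, rfl, h1⟩, (ih q).2 h2⟩

theorem accepts_comap_iff {σ α β : Type} {Δ : σ → α → σ → Prop} {Δ' : σ → β → σ → Prop}
    {F : σ → Prop} {f : β → α} (hΔ : ∀ p c q, Δ' p c q ↔ Δ p (f c) q) (p : σ) (w : List β) :
    Accepts Δ' F p w ↔ Accepts Δ F p (w.map f) := by
  induction w generalizing p with
  | nil => simp only [List.map_nil, accepts_nil_iff]
  | cons c w ih => simp only [List.map_cons, accepts_cons_iff, hΔ, ih]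

theorem FinNFA.mem_language_iff {α : Type} (A : FinNFA α) (w : List α) :
    w ∈ A.language ↔ Accepts (fun p a q => (p, a, q) ∈ A.trans) (· ∈ A.final) A.init w := by
  have key : ∀ (w : List α) (S : Set (Fin A.states)), w ∈ A.toNFA.acceptsFrom S ↔
      ∃ s ∈ S, Accepts (fun p a q => (p, a, q) ∈ A.trans) (· ∈ A.final) s w := by
    intro w
    induction w with
    | nil =>
      intro S
      simp only [NFA.nil_mem_acceptsFrom, accepts_nil_iff]
      rfl
    | cons a w ih =>
      intro S
      simp only [NFA.cons_mem_acceptsFrom, ih, accepts_cons_iff, NFA.mem_stepSet]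
      constructor
      · rintro ⟨q, ⟨p, hp, hq⟩, h⟩
        exact ⟨p, hp, q, hq, h⟩
      · rintro ⟨p, hp, q, hq, h⟩
        exact ⟨q, ⟨p, hp, hq⟩, h⟩
  refine (key w {A.init}).trans ⟨?_, fun h => ⟨_, rfl, h⟩⟩
  rintro ⟨_, rfl, h⟩
  exact h

/-- The automaton with states `0, …, n`, initial state `0`, and given lists of transitions and of
final states. -/
def FinNFA.ofLists {α : Type} (n : ℕ) (tr : List (ℕ × α × ℕ)) (fin : List ℕ) : FinNFA α where
  states := n + 1
  init := 0
  trans := tr.map fun t => (Fin.ofNat (n + 1) t.1, t.2.1, Fin.ofNat (n + 1) t.2.2)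
  final := fin.map (Fin.ofNat (n + 1))

section

variable {α : Type} {n : ℕ} {tr : List (ℕ × α × ℕ)} {fin : List ℕ}

theorem FinNFA.code_ofLists {γ : Type} (c : α → γ) (htr : ∀ t ∈ tr, t.1 ≤ n ∧ t.2.2 ≤ n)
    (hfin : ∀ p ∈ fin, p ≤ n) :
    (FinNFA.ofLists n tr fin).code c = (n + 1, 0, tr.map fun t => (t.1, c t.2.1, t.2.2), fin) := by
  simp only [FinNFA.code, FinNFA.ofLists, List.map_map, Fin.val_zero]
  refine Prod.ext rfl (Prod.ext rfl (Prod.ext ?_ ?_))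
  · refine List.map_congr_left fun t ht => ?_
    have := htr t ht
    simp [Nat.mod_eq_of_lt (Nat.lt_succ_of_le this.1), Nat.mod_eq_of_lt (Nat.lt_succ_of_le this.2)]
  · exact (List.map_congr_left fun p hp =>
      Nat.mod_eq_of_lt (Nat.lt_succ_of_le (hfin p hp))).trans (List.map_id fin)

theorem FinNFA.mem_language_ofLists_iff (htr : ∀ t ∈ tr, t.1 ≤ n ∧ t.2.2 ≤ n)
    (hfin : ∀ p ∈ fin, p ≤ n) (w : List α) : w ∈ (FinNFA.ofLists n tr fin).language ↔
      Accepts (fun p a q => (p, a, q) ∈ tr) (· ∈ fin) 0 w := by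
  rw [FinNFA.mem_language_iff]
  have hval : ∀ p ≤ n, (Fin.ofNat (n + 1) p).val = p := fun p hp =>
    Nat.mod_eq_of_lt (Nat.lt_succ_of_le hp)
  refine (accepts_map_iff (f := Fin.val) Fin.val_injective (fun p a q => ?_) (fun p => ?_) _
    _).symm
  · constructor
    · intro h
      have := htr _ h
      exact ⟨_, _, hval p this.1, hval q this.2, List.mem_map.2 ⟨_, h, rfl⟩⟩
    · rintro ⟨_, _, rfl, rfl, h⟩
      obtain ⟨⟨p, b, q⟩, ht, e⟩ := List.mem_map.1 h
      have := htr _ ht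
      cases e
      change ((Fin.ofNat (n + 1) p).val, b, (Fin.ofNat (n + 1) q).val) ∈ tr
      rw [hval _ this.1, hval _ this.2]
      exact ht
  · constructor
    · intro h
      exact ⟨_, hval p (hfin _ h), List.mem_map.2 ⟨_, h, rfl⟩⟩
    · rintro ⟨_, rfl, h⟩
      obtain ⟨t, ht, rfl⟩ := List.mem_map.1 h
      change (Fin.ofNat (n + 1) t).val ∈ fin
      rw [hval _ (hfin _ ht)]
      exact ht

end

/-! ### The control language -/

/-- The transitions of an automaton for the control language `1 2* (1 2)*`. -/
def aheadTrans : List (ℕ × Tape × ℕ) :=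
  [(0, .one, 1), (1, .two, 1), (1, .one, 2), (2, .two, 3), (3, .one, 2)]

/-- An automaton for the control language `1 2* (1 2)*`. -/
def aheadAutomaton : FinNFA Tape := FinNFA.ofLists 3 aheadTrans [1, 3]

/-- The word `1 2^c₁ 1 2^c₂ ⋯`. -/
def tapeWord : List ℕ → List Tape
  | [] => []
  | c :: cs => .one :: (List.replicate c .two ++ tapeWord cs)

/-- State 1 absorbs the free first block. After the next input letter only states 2 and 3 remain,
and they enforce strict alternation. -/
theorem tapeWord_mem_aheadAutomaton (c : ℕ) (cs : List ℕ) :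
    tapeWord (c :: cs) ∈ aheadAutomaton.language ↔ ∀ d ∈ cs, d = 1 := by
  have h3 : ∀ cs : List ℕ, Accepts (fun p a q => (p, a, q) ∈ aheadTrans) (· ∈ [1, 3]) 3
      (tapeWord cs) ↔ ∀ d ∈ cs, d = 1 := by
    intro cs
    induction cs with
    | nil => simp [tapeWord, accepts_nil_iff]
    | cons d cs ih =>
      rcases d with _ | _ | d
      · cases cs with
        | nil => simp [tapeWord, accepts_cons_iff, aheadTrans, accepts_nil_iff]
        | cons d cs => simp [tapeWord, aheadTrans, accepts_cons_iff]
      · rw [List.forall_mem_cons, ← ih]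
        simp [tapeWord, accepts_cons_iff, aheadTrans]
      · simp [tapeWord, List.replicate_succ, accepts_cons_iff, aheadTrans]
  have h1 : ∀ c : ℕ, Accepts (fun p a q => (p, a, q) ∈ aheadTrans) (· ∈ [1, 3]) 1
      (List.replicate c .two ++ tapeWord cs) ↔ ∀ d ∈ cs, d = 1 := by
    intro c
    induction c with
    | zero =>
      rw [← h3, List.replicate_zero, List.nil_append]
      cases cs with
      | nil => simp [tapeWord, accepts_nil_iff]
      | cons d cs => simp [tapeWord, accepts_cons_iff, aheadTrans]
    | succ c ih =>
      rw [← ih, List.replicate_succ, List.cons_append, accepts_cons_iff]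
      simp [aheadTrans]
  rw [aheadAutomaton, FinNFA.mem_language_ofLists_iff (by simp [aheadTrans]) (by simp), tapeWord,
    accepts_cons_iff, ← h1 c]
  simp [aheadTrans]

/-- The automaton for the synchronization language that corresponds to a control language. -/
def FinNFA.controlSync {n m : ℕ} (A : FinNFA Tape) : FinNFA (Fin n ⊕ Fin m) where
  states := A.states
  init := A.init
  trans := A.trans.flatMap fun t => match t.2.1 with
    | .one => (List.finRange n).map fun a => (t.1, .inl a, t.2.2)
    | .two => (List.finRange m).map fun b => (t.1, .inr b, t.2.2)
  final := A.final

theorem FinNFA.language_controlSync {n m : ℕ} (A : FinNFA Tape) :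
    (A.controlSync : FinNFA (Fin n ⊕ Fin m)).language = _root_.controlSync A.language := by
  ext w
  refine Iff.trans ?_ (FinNFA.mem_language_iff A (w.map tapeOf)).symm
  rw [FinNFA.mem_language_iff]
  refine accepts_comap_iff (fun p c q => ?_) _ _
  refine List.mem_flatMap.trans ⟨?_, fun h => ⟨_, h, ?_⟩⟩
  · rintro ⟨⟨p', t, q'⟩, h1, h2⟩
    cases t
    all_goals
      obtain ⟨a, _, h⟩ := List.mem_map.1 h2
      cases h
      exact h1
  · cases c <;> exact List.mem_map.2 ⟨_, List.mem_finRange _, rfl⟩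

/-! ### Synchronizations over a unary input alphabet -/

/-- The synchronization of `aⁿ` and `v` in which the letters alternate as long as possible. -/
def syncWord {β : Type} : ℕ → List β → List (Fin 1 ⊕ β)
  | 0, v => v.map .inr
  | n + 1, [] => .inl 0 :: syncWord n []
  | n + 1, b :: v => .inl 0 :: .inr b :: syncWord n v

theorem syncPair_syncWord {β : Type} (n : ℕ) (v : List β) :
    syncPair (syncWord n v) = (List.replicate n 0, v) := by
  have hr : ∀ v : List β, (v.map (Sum.inr : β → Fin 1 ⊕ β)).filterMap Sum.getRight? = v := by
    intro v
    induction v <;> simp_all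
  have hl : ∀ v : List β, (v.map (Sum.inr : β → Fin 1 ⊕ β)).filterMap Sum.getLeft? = [] := by
    intro v
    induction v <;> simp_all
  simp only [syncPair]
  induction n generalizing v with
  | zero => simp only [syncWord, hr, hl, List.replicate_zero]
  | succ n ih =>
    cases v with
    | nil =>
      have := Prod.ext_iff.1 (ih [])
      simp only at this
      simp only [syncWord, List.filterMap_cons, Sum.getLeft?, Sum.getRight?, this.1, this.2,
        List.replicate_succ]
    | cons b v =>
      have := Prod.ext_iff.1 (ih v)
      simp only at this
      simp only [syncWord, List.filterMap_cons, Sum.getLeft?, Sum.getRight?, this.1, this.2,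
        List.replicate_succ]

theorem syncWord_mem_synchronous {β : Type} (n : ℕ) (v : List β) (h : n ≤ v.length) :
    syncWord n v ∈ synchronous (Fin 1) β := by
  induction n generalizing v with
  | zero =>
    have : syncWord 0 v ∈ (outputLetters (Fin 1) β)∗ := by
      refine Language.mem_kstar.2 ⟨v.map fun b => [.inr b], ?_, fun y hy => ?_⟩
      · simp only [syncWord]
        induction v <;> simp_all
      · obtain ⟨b, _, rfl⟩ := List.mem_map.1 hy
        exact ⟨b, rfl⟩
    exact Language.mem_mul.2 ⟨[], Language.nil_mem_kstar _, _, Or.inr this, rfl⟩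
  | succ n ih =>
    cases v with
    | nil => simp at h
    | cons b v =>
      obtain ⟨y, hy, z, hz, e⟩ := Language.mem_mul.1 (ih v (by simpa using h))
      refine Language.mem_mul.2 ⟨.inl 0 :: .inr b :: y, ?_, z, hz, by simp [syncWord, ← e]⟩
      refine mul_kstar_le_kstar (a := inputLetters (Fin 1) β * outputLetters (Fin 1) β)
        (Language.mem_mul.2 ⟨[.inl 0, .inr b], ?_, y, hy, rfl⟩)
      exact Language.mem_mul.2 ⟨[.inl 0], ⟨0, rfl⟩, [.inr b], ⟨b, rfl⟩, rfl⟩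

/-! ### The automatic relation -/

/-- States of the automaton whose number does not depend on the input word. -/
inductive HState (B : Type)
  | start
  | one1 | one2
  | two1 | two2 | two3 | two4 | end1 | end2
  | pre | mid
  | r1 | r2 (p : B) | r3 (p : B) | r4 (p q : B) | r5 (s : B) | fin
  | h0 | h1 | h2 | h3 | h4 | h5
  deriving Fintype

/-- The word `v` has a position, not among the last two that are read together with input letters,
at which the machine has halted. -/
def HasHalted {A : Type} (H : A → Prop) (n : ℕ) (v : List (Cell A)) : Prop :=
  ∃ y h z, v = y ++ h :: z ∧ y.length + 3 ≤ n ∧ n < v.length ∧ h.Halted H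

/-- The last letter of `v` is correct in view of the letters at positions `n - 2`, `n - 1`, `n`. -/
def LastCorrect {A : Type} (δ : A → A → A → A) (blank : A) (n : ℕ) (v : List (Cell A)) : Prop :=
  ∃ y p q r z s, v = y ++ p :: q :: r :: (z ++ [s]) ∧ y.length + 2 = n ∧
    cellRule δ blank p q r = some s

/-- A word between unreached cells, followed by the beginning of the next row. -/
def padded {A : Type} (y : List (Cell A)) (l r : ℕ) : List (Cell A) :=
  List.replicate l .out ++ y ++ List.replicate r .out ++ [.wall, .out]

/-- The pairs `(aⁿ, v)` of the automatic relation. -/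
def GoodOutput {A : Type} (δ : A → A → A → A) (blank : A) (H : A → Prop) (x : List A) (n : ℕ)
    (v : List (Cell A)) : Prop :=
  (n = 1 ∧ v ≠ []) ∨ (n = 2 ∧ ∃ l r, v = firstRow x l r) ∨
    (3 ≤ n ∧ (LastCorrect δ blank n v ∨ HasHalted H n v))

section

variable {A : Type} (δ : A → A → A → A) (blank : A) (H : A → Prop) (x : List A)

/-- Transitions that do not depend on the input word. -/
inductive FixedTrans : HState (Cell A) → Fin 1 ⊕ Cell A → HState (Cell A) → Prop
  | one1 : FixedTrans .start (.inl 0) .one1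
  | one2 (b) : FixedTrans .one1 (.inr b) .one2
  | one3 (b) : FixedTrans .one2 (.inr b) .one2
  | two1 : FixedTrans .start (.inl 0) .two1
  | two2 : FixedTrans .two1 (.inr .wall) .two2
  | two3 : FixedTrans .two2 (.inl 0) .two3
  | two4 : FixedTrans .two3 (.inr .out) .two4
  | end2 : FixedTrans .end1 (.inr .out) .end2
  | startPre : FixedTrans .start (.inl 0) .pre
  | preMid (b) : FixedTrans .pre (.inr b) .mid
  | midPre : FixedTrans .mid (.inl 0) .pre
  | r1 : FixedTrans .mid (.inl 0) .r1
  | r2 (p) : FixedTrans .r1 (.inr p) (.r2 p)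
  | r3 (p) : FixedTrans (.r2 p) (.inl 0) (.r3 p)
  | r4 (p q) : FixedTrans (.r3 p) (.inr q) (.r4 p q)
  | r5 (p q r s) : cellRule δ blank p q r = some s → FixedTrans (.r4 p q) (.inr r) (.r5 s)
  | r6 (s b) : FixedTrans (.r5 s) (.inr b) (.r5 s)
  | r7 (s) : FixedTrans (.r5 s) (.inr s) .fin
  | h0 (h) : h.Halted H → FixedTrans .pre (.inr h) .h0
  | h1 : FixedTrans .h0 (.inl 0) .h1
  | h2 (b) : FixedTrans .h1 (.inr b) .h2
  | h3 : FixedTrans .h2 (.inl 0) .h3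
  | h4 (b) : FixedTrans .h3 (.inr b) .h4
  | h5 : FixedTrans .h4 (.inl 0) .h3
  | h6 (b) : FixedTrans .h4 (.inr b) .h5
  | h7 (b) : FixedTrans .h5 (.inr b) .h5

/-- The transitions of the automaton. In the state `Sum.inr j`, the automaton is going to read the
`j`-th letter of the input word in the first row. -/
inductive HelixTrans : HState (Cell A) ⊕ ℕ → Fin 1 ⊕ Cell A → HState (Cell A) ⊕ ℕ → Prop
  | fixed {p a q} : FixedTrans δ blank H p a q → HelixTrans (.inl p) a (.inl q)
  | enter : HelixTrans (.inl .two4) (.inr .out) (.inr 0)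
  | left : HelixTrans (.inr 0) (.inr .out) (.inr 0)
  | read {j} (h : j < x.length) : HelixTrans (.inr j) (.inr (.inn x[j])) (.inr (j + 1))
  | right : HelixTrans (.inr x.length) (.inr .out) (.inr x.length)
  | leave : HelixTrans (.inr x.length) (.inr .wall) (.inl .end1)

/-- The final states. -/
def HState.IsFinal {B : Type} : HState B → Bool
  | .one2 | .end2 | .fin | .h5 => true
  | _ => false

/-- The final states of the automaton. -/
def HelixFinal : HState (Cell A) ⊕ ℕ → Prop
  | .inl p => p.IsFinal = true
  | .inr _ => False

/-- The words that are accepted from a given state. -/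
def rightLanguage : HState (Cell A) ⊕ ℕ → List (Fin 1 ⊕ Cell A) → Prop
  | .inl .start, w => ∃ n v, w = syncWord n v ∧ GoodOutput δ blank H x n v
  | .inl .one1, w => ∃ v, v ≠ [] ∧ w = v.map .inr
  | .inl .one2, w => ∃ v : List (Cell A), w = v.map .inr
  | .inl .two1, w => ∃ l r, w = .inr .wall :: .inl 0 :: .inr .out :: .inr .out ::
      (padded (x.map .inn) l r).map .inr
  | .inl .two2, w => ∃ l r, w = .inl 0 :: .inr .out :: .inr .out ::
      (padded (x.map .inn) l r).map .inr
  | .inl .two3, w => ∃ l r, w = .inr .out :: .inr .out ::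
      (padded (x.map .inn) l r).map .inr
  | .inl .two4, w => ∃ l r, w = .inr .out ::
      (padded (x.map .inn) l r).map .inr
  | .inr j, w => j ≤ x.length ∧ ∃ l r, (l = 0 ∨ j = 0) ∧ w = (padded ((x.drop j).map .inn) l r).map .inr
  | .inl .end1, w => w = [.inr .out]
  | .inl .end2, w => w = []
  | .inl .pre, w => ∃ n b v, w = .inr b :: syncWord n v ∧
      (LastCorrect δ blank n v ∨ HasHalted H (n + 1) (b :: v))
  | .inl .mid, w => ∃ n v, w = syncWord n v ∧ (LastCorrect δ blank n v ∨ HasHalted H n v)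
  | .inl .r1, w => ∃ p q r z s, w = .inr p :: .inl 0 :: .inr q :: .inr r :: (z ++ [s]).map .inr ∧
      cellRule δ blank p q r = some s
  | .inl (.r2 p), w => ∃ q r z s, w = .inl 0 :: .inr q :: .inr r :: (z ++ [s]).map .inr ∧
      cellRule δ blank p q r = some s
  | .inl (.r3 p), w => ∃ q r z s, w = .inr q :: .inr r :: (z ++ [s]).map .inr ∧
      cellRule δ blank p q r = some s
  | .inl (.r4 p q), w => ∃ r z s, w = .inr r :: (z ++ [s]).map .inr ∧
      cellRule δ blank p q r = some s
  | .inl (.r5 s), w => ∃ z, w = (z ++ [s]).map .inr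
  | .inl .fin, w => w = []
  | .inl .h0, w => ∃ n v, w = syncWord n v ∧ 2 ≤ n ∧ n < v.length
  | .inl .h1, w => ∃ n b v, w = .inr b :: syncWord n v ∧ 1 ≤ n ∧ n < v.length
  | .inl .h2, w => ∃ n v, w = syncWord n v ∧ 1 ≤ n ∧ n < v.length
  | .inl .h3, w => ∃ n b v, w = .inr b :: syncWord n v ∧ n < v.length
  | .inl .h4, w => ∃ n v, w = syncWord n v ∧ n < v.length
  | .inl .h5, w => ∃ v : List (Cell A), w = v.map .inr

variable {δ blank H x}

theorem LastCorrect.cons {n : ℕ} {v : List (Cell A)} (h : LastCorrect δ blank n v) (b : Cell A) :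
    LastCorrect δ blank (n + 1) (b :: v) := by
  obtain ⟨y, p, q, r, z, s, rfl, h1, h2⟩ := h
  exact ⟨b :: y, p, q, r, z, s, rfl, by simp [← h1], h2⟩

theorem HasHalted.cons {n : ℕ} {v : List (Cell A)} (h : HasHalted H n v) (b : Cell A) :
    HasHalted H (n + 1) (b :: v) := by
  obtain ⟨y, c, z, rfl, h1, h2, h3⟩ := h
  exact ⟨b :: y, c, z, rfl, by simp; omega, by simpa using h2, h3⟩

theorem rightLanguage_of_accepts {p : HState (Cell A) ⊕ ℕ} {w : List (Fin 1 ⊕ Cell A)}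
    (h : Accepts (HelixTrans δ blank H x) HelixFinal p w) : rightLanguage δ blank H x p w := by
  induction h with
  | @nil p h =>
    rcases p with p | j
    · cases p <;> simp_all [HelixFinal, HState.IsFinal, rightLanguage]
    · exact h.elim
  | cons h _ ih =>
    cases h with
    | fixed h =>
      cases h with
      | one1 =>
        obtain ⟨v, h1, rfl⟩ := ih
        obtain ⟨b, v, rfl⟩ := List.exists_cons_of_ne_nil h1
        exact ⟨1, b :: v, rfl, Or.inl ⟨rfl, h1⟩⟩
      | one2 b =>
        obtain ⟨v, rfl⟩ := ih
        exact ⟨b :: v, by simp, rfl⟩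
      | one3 b =>
        obtain ⟨v, rfl⟩ := ih
        exact ⟨b :: v, rfl⟩
      | two1 =>
        obtain ⟨l, r, rfl⟩ := ih
        exact ⟨2, firstRow x l r, rfl, Or.inr (Or.inl ⟨rfl, l, r, rfl⟩)⟩
      | two2 =>
        obtain ⟨l, r, rfl⟩ := ih
        exact ⟨l, r, rfl⟩
      | two3 =>
        obtain ⟨l, r, rfl⟩ := ih
        exact ⟨l, r, rfl⟩
      | two4 =>
        obtain ⟨l, r, rfl⟩ := ih
        exact ⟨l, r, rfl⟩
      | end2 =>
        cases ih
        rfl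
      | startPre =>
        obtain ⟨n, b, v, rfl, h⟩ := ih
        refine ⟨n + 1, b :: v, rfl, Or.inr (Or.inr ?_)⟩
        rcases h with h | h
        · refine ⟨?_, Or.inl (h.cons b)⟩
          obtain ⟨y, p, q, r, z, s, _, h1, _⟩ := h
          omega
        · refine ⟨?_, Or.inr h⟩
          obtain ⟨y, c, z, _, h1, _, _⟩ := h
          omega
      | preMid b =>
        obtain ⟨n, v, rfl, h⟩ := ih
        exact ⟨n, b, v, rfl, h.imp_right fun h => h.cons b⟩
      | midPre =>
        obtain ⟨n, b, v, rfl, h⟩ := ih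
        exact ⟨n + 1, b :: v, rfl, h.imp_left fun h => h.cons b⟩
      | r1 =>
        obtain ⟨p, q, r, z, s, rfl, h⟩ := ih
        exact ⟨2, p :: q :: r :: (z ++ [s]), rfl, Or.inl ⟨[], p, q, r, z, s, rfl, rfl, h⟩⟩
      | r2 p =>
        obtain ⟨q, r, z, s, rfl, h⟩ := ih
        exact ⟨p, q, r, z, s, rfl, h⟩
      | r3 p =>
        obtain ⟨q, r, z, s, rfl, h⟩ := ih
        exact ⟨q, r, z, s, rfl, h⟩
      | r4 p q =>
        obtain ⟨r, z, s, rfl, h⟩ := ih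
        exact ⟨q, r, z, s, rfl, h⟩
      | r5 p q r s h =>
        obtain ⟨z, rfl⟩ := ih
        exact ⟨r, z, s, rfl, h⟩
      | r6 s b =>
        obtain ⟨z, rfl⟩ := ih
        exact ⟨b :: z, rfl⟩
      | r7 s =>
        cases ih
        exact ⟨[], rfl⟩
      | h0 c hc =>
        obtain ⟨n, v, rfl, h1, h2⟩ := ih
        exact ⟨n, c, v, rfl, Or.inr ⟨[], c, v, rfl, by simp; omega, by simpa using h2, hc⟩⟩
      | h1 =>
        obtain ⟨n, b, v, rfl, h1, h2⟩ := ih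
        exact ⟨n + 1, b :: v, rfl, by omega, by simpa using h2⟩
      | h2 b =>
        obtain ⟨n, v, rfl, h1, h2⟩ := ih
        exact ⟨n, b, v, rfl, h1, h2⟩
      | h3 =>
        obtain ⟨n, b, v, rfl, h2⟩ := ih
        exact ⟨n + 1, b :: v, rfl, by omega, by simpa using h2⟩
      | h4 b =>
        obtain ⟨n, v, rfl, h2⟩ := ih
        exact ⟨n, b, v, rfl, h2⟩
      | h5 =>
        obtain ⟨n, b, v, rfl, h2⟩ := ih
        exact ⟨n + 1, b :: v, rfl, by simpa using h2⟩
      | h6 b =>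
        obtain ⟨v, rfl⟩ := ih
        exact ⟨0, b :: v, rfl, by simp⟩
      | h7 b =>
        obtain ⟨v, rfl⟩ := ih
        exact ⟨b :: v, rfl⟩
    | enter =>
      obtain ⟨_, l, r, _, rfl⟩ := ih
      exact ⟨l, r, rfl⟩
    | left =>
      obtain ⟨_, l, r, _, rfl⟩ := ih
      exact ⟨by omega, l + 1, r, Or.inr rfl, rfl⟩
    | read h =>
      obtain ⟨_, l, r, h1, rfl⟩ := ih
      obtain rfl : l = 0 := by omega
      exact ⟨by omega, 0, r, Or.inl rfl, by rw [List.drop_eq_getElem_cons h]; rfl⟩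
    | right =>
      obtain ⟨_, l, r, h1, rfl⟩ := ih
      -- For empty `x` the states of the left and right paddings coincide, so `l` may be nonzero and
      -- is merged into the right padding.
      refine ⟨le_rfl, 0, l + r + 1, Or.inl rfl, ?_⟩
      have : padded ((x.drop x.length).map Cell.inn) 0 (l + r + 1) =
          .out :: padded ((x.drop x.length).map Cell.inn) l r := by
        simp [padded, ← List.replicate_append_replicate, List.replicate_succ]
      rw [this]
      rfl
    | leave =>
      cases ih
      exact ⟨le_rfl, 0, 0, Or.inl rfl, by simp [padded]⟩

theorem accepts_syncWord_of_lt {n : ℕ} {v : List (Cell A)} (h : n < v.length) :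
    Accepts (HelixTrans δ blank H x) HelixFinal (.inl .h4) (syncWord n v) := by
  have h5 : ∀ v : List (Cell A),
      Accepts (HelixTrans δ blank H x) HelixFinal (.inl .h5) (v.map .inr) := by
    intro v
    induction v with
    | nil => exact .nil rfl
    | cons b v ih => exact .cons (.fixed (.h7 b)) ih
  induction n generalizing v with
  | zero =>
    cases v with
    | nil => simp at h
    | cons b v => exact .cons (.fixed (.h6 b)) (h5 v)
  | succ n ih =>
    cases v with
    | nil => simp at h
    | cons b v => exact .cons (.fixed .h5) (.cons (.fixed (.h4 b)) (ih (by simpa using h)))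

theorem accepts_syncWord_of_halted {n : ℕ} {v : List (Cell A)} (hn : 2 ≤ n) (h : n < v.length) :
    Accepts (HelixTrans δ blank H x) HelixFinal (.inl .h0) (syncWord n v) := by
  obtain ⟨n, rfl⟩ : ∃ m, n = m + 2 := ⟨n - 2, by omega⟩
  obtain ⟨b, v, rfl⟩ := List.exists_cons_of_length_pos (by omega : 0 < v.length)
  obtain ⟨c, v, rfl⟩ := List.exists_cons_of_length_pos (by simp at h; omega : 0 < v.length)
  exact .cons (.fixed .h1) (.cons (.fixed (.h2 b)) (.cons (.fixed .h3) (.cons (.fixed (.h4 c))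
    (accepts_syncWord_of_lt (by simpa using h)))))

/-- The automaton guesses when two input letters remain and stores the letters `p`, `q` read with
them. The next output letter is `r`, so the expected last letter can be kept in the state `r5`.
Alternatively it guesses a halted letter and then checks only lengths. -/
theorem accepts_mid {n : ℕ} {v : List (Cell A)} (h : LastCorrect δ blank n v ∨ HasHalted H n v) :
    Accepts (HelixTrans δ blank H x) HelixFinal (.inl .mid) (syncWord n v) := by
  have h5 : ∀ (s : Cell A) (z : List (Cell A)),
      Accepts (HelixTrans δ blank H x) HelixFinal (.inl (.r5 s)) ((z ++ [s]).map .inr) := by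
    intro s z
    induction z with
    | nil => exact .cons (.fixed (.r7 s)) (.nil rfl)
    | cons b z ih => exact .cons (.fixed (.r6 s b)) ih
  rcases h with ⟨y, p, q, r, z, s, rfl, h1, h2⟩ | ⟨y, h, z, rfl, h1, h2, h3⟩
  · induction y generalizing n with
    | nil =>
      subst h1
      exact .cons (.fixed .r1) (.cons (.fixed (.r2 p)) (.cons (.fixed (.r3 p))
        (.cons (.fixed (.r4 p q)) (.cons (.fixed (.r5 p q r s h2)) (h5 s z)))))
    | cons b y ih =>
      obtain ⟨n, rfl⟩ : ∃ m, n = m + 1 := ⟨n - 1, by simp at h1; omega⟩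
      exact .cons (.fixed .midPre) (.cons (.fixed (.preMid b)) (ih (by simp at h1; omega)))
  · induction y generalizing n with
    | nil =>
      obtain ⟨n, rfl⟩ : ∃ m, n = m + 1 := ⟨n - 1, by simp at h1; omega⟩
      exact .cons (.fixed .midPre) (.cons (.fixed (.h0 h h3))
        (accepts_syncWord_of_halted (by simp at h1; omega) (by simpa using h2)))
    | cons b y ih =>
      obtain ⟨n, rfl⟩ : ∃ m, n = m + 1 := ⟨n - 1, by simp at h1; omega⟩
      exact .cons (.fixed .midPre) (.cons (.fixed (.preMid b))
        (ih (by simp at h1; omega) (by simpa using h2)))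

theorem accepts_padded (l r : ℕ) : Accepts (HelixTrans δ blank H x) HelixFinal (.inr 0)
    ((padded (x.map .inn) l r).map .inr) := by
  have hr : ∀ r : ℕ, Accepts (HelixTrans δ blank H x) HelixFinal (.inr x.length)
      ((padded [] 0 r).map .inr) := by
    intro r
    induction r with
    | zero => exact .cons .leave (.cons (.fixed .end2) (.nil rfl))
    | succ r ih => exact .cons .right ih
  have hx : ∀ (y : List A) (j : ℕ), j ≤ x.length → x.drop j = y →
      Accepts (HelixTrans δ blank H x) HelixFinal (.inr j)
        ((padded (y.map .inn) 0 r).map .inr) := by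
    intro y
    induction y with
    | nil =>
      intro j hj h
      have := congrArg List.length h
      simp at this
      obtain rfl : j = x.length := by omega
      exact hr r
    | cons a y ih =>
      intro j hj h
      have hj' : j < x.length := by
        by_contra hcon
        rw [List.drop_eq_nil_of_le (by omega)] at h
        cases h
      rw [List.drop_eq_getElem_cons hj', List.cons.injEq] at h
      obtain ⟨rfl, h⟩ := h
      exact .cons (.read hj') (ih (j + 1) hj' h)
  induction l with
  | zero => exact hx x 0 (Nat.zero_le _) rfl
  | succ l ih => exact .cons .left ih

theorem accepts_helix_iff (w : List (Fin 1 ⊕ Cell A)) :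
    Accepts (HelixTrans δ blank H x) HelixFinal (.inl .start) w ↔
      ∃ n v, w = syncWord n v ∧ GoodOutput δ blank H x n v := by
  refine ⟨fun h => rightLanguage_of_accepts h, ?_⟩
  rintro ⟨n, v, rfl, ⟨rfl, hv⟩ | ⟨rfl, l, r, rfl⟩ | ⟨hn, h⟩⟩
  · obtain ⟨b, v, rfl⟩ := List.exists_cons_of_ne_nil hv
    refine .cons (.fixed .one1) (.cons (.fixed (.one2 b)) ?_)
    change Accepts (HelixTrans δ blank H x) HelixFinal (.inl .one2) (v.map .inr)
    clear hv
    induction v with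
    | nil => exact .nil rfl
    | cons b v ih => exact .cons (.fixed (.one3 b)) ih
  · exact .cons (.fixed .two1) (.cons (.fixed .two2) (.cons (.fixed .two3)
      (.cons (.fixed .two4) (.cons .enter (accepts_padded l r)))))
  · obtain ⟨n, rfl⟩ : ∃ m, n = m + 1 := ⟨n - 1, by omega⟩
    rcases h with ⟨y, p, q, r, z, s, rfl, h1, h2⟩ | ⟨y, h, z, rfl, h1, h2, h3⟩
    · obtain ⟨b, y, rfl⟩ := List.exists_cons_of_length_pos (by omega : 0 < y.length)
      exact .cons (.fixed .startPre) (.cons (.fixed (.preMid b))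
        (accepts_mid (Or.inl ⟨y, p, q, r, z, s, rfl, by simp at h1; omega, h2⟩)))
    · cases y with
      | nil =>
        exact .cons (.fixed .startPre) (.cons (.fixed (.h0 h h3))
          (accepts_syncWord_of_halted (by simp at h1; omega) (by simpa using h2)))
      | cons b y =>
        exact .cons (.fixed .startPre) (.cons (.fixed (.preMid b))
          (accepts_mid (Or.inr ⟨y, h, z, rfl, by simp at h1; omega, by simpa using h2, h3⟩)))

/-- This excludes the empty input from the domain, and it makes the synchronizations alternate until
the input is exhausted. -/
theorem GoodOutput.le_length {n : ℕ} {v : List (Cell A)} (h : GoodOutput δ blank H x n v) :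
    1 ≤ n ∧ n ≤ v.length := by
  rcases h with ⟨rfl, hv⟩ | ⟨rfl, l, r, rfl⟩ | ⟨hn, ⟨y, p, q, r, z, s, rfl, h1, -⟩ |
    ⟨y, h, z, rfl, h1, h2, -⟩⟩
  · exact ⟨le_rfl, List.length_pos_iff.2 hv⟩
  · simp [firstRow]
  · simp
    omega
  · omega

end

/-! ### Transducers over a unary input alphabet -/

section

variable {A : Type} {δ : A → A → A → A} {blank : A} {H : A → Prop} {x : List A}

theorem goodOutput_of_isHelix {k : ℕ} {V : ℕ → Cell A} (h : IsHelix δ blank H x k V) {n : ℕ}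
    (hn : 1 ≤ n) : GoodOutput δ blank H x n ((List.range (n + k)).map V) := by
  obtain ⟨l, r, hlr⟩ := h.first
  have hk : 3 ≤ k := by
    have := congrArg List.length hlr
    simp [firstRow] at this
    omega
  rcases (show n = 1 ∨ n = 2 ∨ 3 ≤ n by omega) with rfl | rfl | hn
  · exact Or.inl ⟨rfl, by simp⟩
  · exact Or.inr (Or.inl ⟨rfl, l, r, by rw [add_comm, hlr]⟩)
  · refine Or.inr (Or.inr ⟨hn, ?_⟩)
    -- The condition on the output for `aⁿ` is the rule of the helix at `m = n - 2`.
    obtain ⟨m, rfl⟩ : ∃ m, n = m + 2 := ⟨n - 2, by omega⟩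
    obtain ⟨k, rfl⟩ : ∃ j, k = j + 2 := ⟨k - 2, by omega⟩
    rcases h.rule m (by omega) with ⟨i, hi, hV⟩ | hV
    · refine Or.inr ⟨(List.range i).map V, V i,
        (List.range (m + k + 3 - i)).map fun j => V (i + 1 + j), ?_, by simp; omega, by simp, hV⟩
      rw [show m + 2 + (k + 2) = i + (m + k + 3 - i + 1) by omega, List.range_add,
        List.range_succ_eq_map]
      simp [Function.comp_def, add_comm, add_left_comm]
    · refine Or.inl ⟨(List.range m).map V, V m, V (m + 1), V (m + 2),
        (List.range k).map fun j => V (m + 3 + j), V (m + 1 + (k + 2)), ?_, by simp, hV⟩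
      rw [show m + 2 + (k + 2) = m + (k + 1 + 1 + 1 + 1) by omega, List.range_add,
        List.range_succ_eq_map, List.range_succ_eq_map, List.range_succ_eq_map, List.range_succ]
      simp [Function.comp_def, add_assoc, add_comm, add_left_comm]

theorem isHelix_of_goodOutput {k : ℕ} {V : ℕ → Cell A}
    (h : ∀ n, 2 ≤ n → GoodOutput δ blank H x n ((List.range (n + k)).map V)) :
    IsHelix δ blank H x k V := by
  constructor
  · rcases h 2 le_rfl with ⟨h1, -⟩ | ⟨-, l, r, h1⟩ | ⟨h1, -⟩
    · omega
    · exact ⟨l, r, by rw [add_comm, h1]⟩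
    · omega
  · intro m hm
    have hget : ∀ i < m + 2 + k, ((List.range (m + 2 + k)).map V)[i]? = some (V i) := by
      intro i hi
      simp [hi]
    rcases h (m + 2) (by omega) with ⟨h1, -⟩ | ⟨h1, -⟩ | ⟨-, ⟨y, p, q, r, z, s, h1, h2, h3⟩ |
      ⟨y, c, z, h1, h2, h3, h4⟩⟩
    · omega
    · omega
    · right
      -- The last letter `s` has index `y.length + 3 + z.length`, which the length of the output
      -- identifies with `m + 1 + k`.
      obtain rfl : m = y.length := by omega
      have hlen := congrArg List.length h1
      simp at hlen
      rw [h1] at hget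
      have e1 := hget y.length (by omega)
      have e2 := hget (y.length + 1) (by omega)
      have e3 := hget (y.length + 2) (by omega)
      have e4 := hget (y.length + (3 + z.length)) (by omega)
      rw [List.getElem?_append_right (by omega)] at e1 e2 e3 e4
      simp [show 3 + z.length = z.length + 1 + 1 + 1 by omega] at e1 e2 e3 e4
      rw [← e1, ← e2, ← e3, h3, e4]
      congr 2
      omega
    · left
      have hlen := congrArg List.length h1
      simp at hlen
      refine ⟨y.length, by omega, ?_⟩
      have e1 := hget y.length (by omega)
      rw [h1] at e1
      simp at e1
      rwa [← e1]

/-- Every number of input letters is in the domain of the relation, except zero. -/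
theorem exists_goodOutput {n : ℕ} (hn : 1 ≤ n) :
    ∃ v, GoodOutput δ blank H x n v := by
  rcases (show n = 1 ∨ n = 2 ∨ 3 ≤ n by omega) with rfl | rfl | hn
  · exact ⟨[.out], Or.inl ⟨rfl, by simp⟩⟩
  · exact ⟨firstRow x 0 0, Or.inr (Or.inl ⟨rfl, 0, 0, rfl⟩)⟩
  · exact ⟨_, Or.inr (Or.inr ⟨hn, Or.inl ⟨List.replicate (n - 2) .out, .out, .out, .out, [], .out,
      rfl, by simp; omega, by simp [cellRule, Cell.isInn]⟩⟩)⟩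

end

theorem list_fin_one_eq_replicate (u : List (Fin 1)) : u = List.replicate u.length 0 :=
  List.eq_replicate_iff.2 ⟨rfl, fun _ _ => Subsingleton.elim _ _⟩

theorem tapeWord_append_replicate (cs : List ℕ) (d c : ℕ) :
    tapeWord (cs ++ [d]) ++ List.replicate c .two = tapeWord (cs ++ [d + c]) := by
  induction cs with
  | nil => simp [tapeWord]
  | cons a cs ih => simp [tapeWord, ← ih]

theorem map_tapeOf_inr {α β : Type} (v : List β) :
    (v.map (Sum.inr : β → α ⊕ β)).map tapeOf = List.replicate v.length .two := by
  induction v with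
  | nil => rfl
  | cons b v ih => simpa [tapeOf, List.replicate_succ] using ih

/-! ### Runs of controlled transducers -/

section

variable {β Q : Type} {T : SubseqTransducer (Fin 1) β Q}

/-- Being defined on all nonempty inputs passes from a state to its successor, so the unique run
never gets stuck. -/
theorem SubseqTransducer.exists_run (h : ∀ n, 1 ≤ n → ∃ v, T.eval (List.replicate n 0) = some v) :
    ∃ (q : ℕ → Q) (o : ℕ → List β), q 0 = T.init ∧ ∀ i, T.step (q i) 0 = some (o i, q (i + 1)) := by
  let P : Q → Prop := fun q => ∀ n, 1 ≤ n → ∃ v, T.evalFrom q (List.replicate n 0) = some v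
  have hP : ∀ q : {q // P q}, ∃ s : List β × {q // P q}, T.step q.1 0 = some (s.1, s.2.1) := by
    rintro ⟨q, hq⟩
    cases e : T.step q 0 with
    | none =>
      obtain ⟨v, hv⟩ := hq 1 le_rfl
      simp [SubseqTransducer.evalFrom, e] at hv
    | some s =>
      refine ⟨(s.1, ⟨s.2, fun n hn => ?_⟩), rfl⟩
      obtain ⟨v, hv⟩ := hq (n + 1) (by omega)
      rw [List.replicate_succ, SubseqTransducer.evalFrom, e, Option.bind_some,
        Option.map_eq_some_iff] at hv
      obtain ⟨v', hv', -⟩ := hv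
      exact ⟨v', hv'⟩
  choose f hf using hP
  let g : ℕ → {q // P q} := fun n => Nat.rec ⟨T.init, h⟩ (fun _ q => (f q).2) n
  exact ⟨fun i => (g i).1, fun i => (f (g i)).1, rfl, fun i => hf (g i)⟩

theorem SubseqTransducer.evalFrom_run {q : ℕ → Q} {o : ℕ → List β}
    (h : ∀ i, T.step (q i) 0 = some (o i, q (i + 1))) (n i : ℕ) :
    T.evalFrom (q i) (List.replicate n 0) =
      (T.final (q (i + n))).map fun v => ((List.range n).flatMap fun j => o (i + j)) ++ v := by
  induction n generalizing i with
  | zero => simp [SubseqTransducer.evalFrom]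
  | succ n ih =>
    rw [List.replicate_succ, SubseqTransducer.evalFrom, h, Option.bind_some, ih, Option.map_map,
      List.range_succ_eq_map, List.flatMap_cons, List.flatMap_map, show i + (n + 1) = i + 1 + n by
        ring]
    congr 1
    funext v
    simp [add_comm, add_left_comm]

theorem SubseqTransducer.syncFrom_run {q : ℕ → Q} {o : ℕ → List β}
    (h : ∀ i, T.step (q i) 0 = some (o i, q (i + 1))) (n i : ℕ) {v : List β}
    (hv : T.final (q (i + n)) = some v) : ∃ w, T.syncFrom (q i) (List.replicate n 0) = some w ∧
      w.map tapeOf = tapeWord ((List.range n).map fun j => (o (i + j)).length) ++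
        List.replicate v.length .two := by
  induction n generalizing i with
  | zero =>
    refine ⟨v.map .inr, ?_, map_tapeOf_inr v⟩
    rw [add_zero] at hv
    simp [SubseqTransducer.syncFrom, hv]
  | succ n ih =>
    obtain ⟨w, h1, h2⟩ := ih (i + 1) (by rw [← hv]; congr 2; ring)
    refine ⟨.inl 0 :: ((o i).map .inr ++ w), ?_, ?_⟩
    · rw [List.replicate_succ, SubseqTransducer.syncFrom, h, Option.bind_some, h1]
      rfl
    · rw [List.map_cons, List.map_append, map_tapeOf_inr, h2, List.range_succ_eq_map, List.map_cons,
        tapeWord, List.map_map]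
      simp [tapeOf, Function.comp_def, add_comm, add_left_comm]

/-- If a transducer follows the control language `1 2* (1 2)*` and is defined on all nonempty
inputs, then its outputs are prefixes of one infinite word. -/
theorem SubseqTransducer.exists_infinite_output
    (hT : T.IsControlled (controlSync aheadAutomaton.language))
    (h : ∀ n, 1 ≤ n → ∃ v, T.eval (List.replicate n 0) = some v) :
    ∃ (c : ℕ) (V : ℕ → β), ∀ n, 2 ≤ n →
      T.eval (List.replicate n 0) = some ((List.range (c + (n - 1))).map V) := by
  obtain ⟨q, o, hq, hstep⟩ := SubseqTransducer.exists_run h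
  have heval : ∀ n, T.eval (List.replicate n 0) =
      (T.final (q n)).map fun v => ((List.range n).flatMap o) ++ v := by
    intro n
    have := SubseqTransducer.evalFrom_run hstep n 0
    simp only [zero_add, hq] at this
    exact this
  have hfinal : ∀ n, 2 ≤ n → ∃ v, T.final (q n) = some v ∧ (∀ j, 1 ≤ j → j + 1 < n →
      (o j).length = 1) ∧ (o (n - 1)).length + v.length = 1 := by
    intro n hn
    obtain ⟨m, rfl⟩ : ∃ m, n = m + 2 := ⟨n - 2, by omega⟩
    obtain ⟨u, hu⟩ := h (m + 2) (by omega)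
    rw [heval, Option.map_eq_some_iff] at hu
    obtain ⟨v, hv, -⟩ := hu
    obtain ⟨w, hw, hw'⟩ := SubseqTransducer.syncFrom_run hstep (m + 2) 0 (v := v) (by rwa [zero_add])
    have hmem : w.map tapeOf ∈ aheadAutomaton.language := hT w ⟨_, hq ▸ hw⟩
    simp only [zero_add] at hw'
    -- The final output extends the block of the last input letter, so the control bounds their
    -- total length.
    rw [hw', List.range_succ, List.map_append, List.map_cons, List.map_nil,
      tapeWord_append_replicate, List.range_succ_eq_map, List.map_cons, List.cons_append,
      tapeWord_mem_aheadAutomaton] at hmem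
    refine ⟨v, hv, fun j hj hj' => ?_, ?_⟩
    · refine hmem _ (List.mem_append_left _ (List.mem_map.2 ⟨j, List.mem_map.2 ⟨j - 1, ?_, ?_⟩, rfl⟩))
      · exact List.mem_range.2 (by omega)
      · omega
    · exact hmem _ (List.mem_append_right _ (by simp))
  -- Step `j` is not the last step on `j + 2` letters, so no final output interferes.
  have hone : ∀ j, 1 ≤ j → (o j).length = 1 := fun j hj =>
    (hfinal (j + 2) (by omega)).choose_spec.2.1 j hj (by omega)
  have hb : ∀ j, ∃ b, o (j + 1) = [b] := fun j => List.length_eq_one_iff.1 (hone (j + 1) (by omega))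
  choose b hb using hb
  refine ⟨(o 0).length, fun i => if h : i < (o 0).length then (o 0)[i] else b (i - (o 0).length),
    fun n hn => ?_⟩
  obtain ⟨v, hv, -, hlen⟩ := hfinal n hn
  -- The last step already writes the only letter that the control allows.
  have hv0 : v = [] := by
    rw [hone _ (by omega)] at hlen
    exact List.length_eq_zero_iff.1 (by omega)
  obtain ⟨m, rfl⟩ : ∃ m, n = m + 1 := ⟨n - 1, by omega⟩
  rw [heval, hv, hv0, Option.map_some, List.append_nil, List.range_succ_eq_map, List.flatMap_cons,
    List.flatMap_map, Nat.add_sub_cancel, List.range_add, List.map_append, List.map_map]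
  congr 2
  · refine List.ext_getElem (by simp) fun i h1 h2 => ?_
    simp [h1]
  · simp only [Nat.succ_eq_add_one, hb, Function.comp_def]
    rw [← List.map_eq_flatMap]
    exact List.map_congr_left fun i _ => by simp

end

/-! ### A transducer writing an eventually constant word -/

section

variable {β : Type}

/-- The transducer that first outputs the letters `0, …, k` of an infinite word that is constant
from position `N` on, and then one letter per step. -/
def aheadTransducer (V : ℕ → β) (k N : ℕ) :
    SubseqTransducer (Fin 1) β {i : ℕ // i ≤ N + 1} where
  init := ⟨0, Nat.zero_le _⟩
  step q _ :=
    if q.1 = 0 then some ((List.range (k + 1)).map V, ⟨1, by omega⟩)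
    else some ([V (k + q.1)], ⟨min (q.1 + 1) (N + 1), min_le_right _ _⟩)
  final q := if q.1 = 0 then none else some []

variable {V : ℕ → β} {k N : ℕ} (hV : ∀ i, N ≤ i → V i = V N)

include hV in
-- The counter may saturate at `N + 1` because all letters from position `N` on are equal.
theorem aheadTransducer_step (j : ℕ) :
    (aheadTransducer V k N).step ⟨min (j + 1) (N + 1), min_le_right _ _⟩ 0 =
      some ([V (k + (j + 1))], ⟨min (j + 1 + 1) (N + 1), min_le_right _ _⟩) := by
  simp only [aheadTransducer]
  rw [if_neg (by omega)]
  have h1 : V (k + min (j + 1) (N + 1)) = V (k + (j + 1)) := by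
    rcases le_total (j + 1) (N + 1) with h | h
    · rw [min_eq_left h]
    · rw [min_eq_right h, hV _ (by omega), hV (k + (j + 1)) (by omega)]
  rw [h1]
  congr 3
  omega

include hV in
theorem exists_aheadTransducer_run : ∃ (q : ℕ → {i : ℕ // i ≤ N + 1}) (o : ℕ → List β),
    q 0 = (aheadTransducer V k N).init ∧
    (∀ i, (aheadTransducer V k N).step (q i) 0 = some (o i, q (i + 1))) ∧
    (∀ i, (aheadTransducer V k N).final (q (i + 1)) = some []) ∧
    o 0 = (List.range (k + 1)).map V ∧ ∀ i, o (i + 1) = [V (k + 1 + i)] := by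
  refine ⟨fun i => ⟨min i (N + 1), min_le_right _ _⟩,
    fun i => match i with
      | 0 => (List.range (k + 1)).map V
      | i + 1 => [V (k + 1 + i)], ?_, fun i => ?_, fun i => ?_, rfl, fun i => rfl⟩
  · simp [aheadTransducer]
  · cases i with
    | zero => simp [aheadTransducer]
    | succ i =>
      rw [aheadTransducer_step hV]
      simp only [show k + (i + 1) = k + 1 + i by ring]
  · simp [aheadTransducer]

include hV in
theorem aheadTransducer_eval (n : ℕ) :
    (aheadTransducer V k N).eval (List.replicate (n + 1) 0) =
      some ((List.range (n + 1 + k)).map V) := by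
  obtain ⟨q, o, h0, h1, h2, h3, h4⟩ := exists_aheadTransducer_run (k := k) hV
  rw [SubseqTransducer.eval, ← h0, SubseqTransducer.evalFrom_run h1, zero_add, h2]
  simp only [zero_add, Option.map_some, List.append_nil, Option.some.injEq]
  rw [List.range_succ_eq_map, List.flatMap_cons, List.flatMap_map, h3,
    show n + 1 + k = k + 1 + n by ring, List.range_add (n := k + 1), List.map_append,
    List.map_map]
  simp only [Nat.succ_eq_add_one, h4, Function.comp_def]
  rw [← List.map_eq_flatMap]

include hV in
theorem aheadTransducer_isControlled :
    (aheadTransducer V k N).IsControlled (controlSync aheadAutomaton.language) := by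
  rintro w ⟨u, hu⟩
  obtain ⟨q, o, h0, h1, h2, h3, h4⟩ := exists_aheadTransducer_run (k := k) hV
  rw [list_fin_one_eq_replicate u] at hu
  cases hn : u.length with
  | zero => simp [hn, SubseqTransducer.syncFrom, aheadTransducer] at hu
  | succ n =>
    obtain ⟨w', hw, hw'⟩ := SubseqTransducer.syncFrom_run h1 (n + 1) 0 (v := []) (by
      rw [zero_add, h2])
    rw [hn, ← h0, hw] at hu
    obtain rfl := Option.some.inj hu
    change w'.map tapeOf ∈ aheadAutomaton.language
    rw [hw', List.length_nil, List.replicate_zero, List.append_nil, List.range_succ_eq_map,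
      List.map_cons, tapeWord_mem_aheadAutomaton]
    simp [h4]

end

/-- The relation has a uniformization that follows the control language `1 2* (1 2)*` if and only if
the cellular automaton halts. -/
theorem hasControlledUniformization_iff {A β : Type} {δ : A → A → A → A} {blank : A}
    {H : A → Prop} {x : List A} (hδ : δ blank blank blank = blank) (hH : ¬ H blank) (hx : x ≠ [])
    (e : Cell A ≃ β) (R : Set (List (Fin 1) × List β))
    (hR : ∀ u v, (u, v) ∈ R ↔ GoodOutput δ blank H x u.length (v.map e.symm)) :
    HasControlledUniformization R (controlSync aheadAutomaton.language) ↔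
      ∃ t z, H (caOrbit δ blank x t z) := by
  have hdom : ∀ u, (∃ v, (u, v) ∈ R) ↔ 1 ≤ u.length := by
    intro u
    constructor
    · rintro ⟨v, hv⟩
      exact ((hR u v).1 hv).le_length.1
    · intro hu
      obtain ⟨v, hv⟩ := exists_goodOutput (H := H) (x := x) hu
      exact ⟨v.map e, (hR _ _).2 (by simpa using hv)⟩
  constructor
  · rintro ⟨Q, _, T, hT, hT1, hT2⟩
    obtain ⟨c, V, hV⟩ := SubseqTransducer.exists_infinite_output hT fun n hn =>
      (hT1 _).1 ((hdom _).2 (by simpa using hn))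
    have hgood : ∀ n, 2 ≤ n →
        GoodOutput δ blank H x n ((List.range (c + (n - 1))).map fun i => e.symm (V i)) := by
      intro n hn
      have := (hR _ _).1 (hT2 _ _ (hV n hn))
      simpa [Function.comp_def] using this
    -- The output for `n = 2` has length `c + 1` and is a first row, so `c` is positive. The shift
    -- gives outputs of length `n + k`.
    obtain ⟨k, rfl⟩ : ∃ k, c = k + 1 := by
      rcases hgood 2 le_rfl with ⟨h, -⟩ | ⟨-, l, r, h⟩ | ⟨h, -⟩
      · omega
      · have := congrArg List.length h
        simp [firstRow] at this
        exact ⟨c - 1, by omega⟩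
      · omega
    refine exists_halting_of_isHelix (k := k) (V := fun i => e.symm (V i)) hδ hx
      (isHelix_of_goodOutput fun n hn => ?_)
    have := hgood n hn
    rwa [show k + 1 + (n - 1) = n + k by omega] at this
  · intro h
    obtain ⟨k, V, ⟨N, hN⟩, hV⟩ := exists_isHelix hδ hH hx h
    have hN' : ∀ i, N ≤ i → e (V i) = e (V N) := fun i hi => by rw [hN i hi, hN N le_rfl]
    refine ⟨_, inferInstance, aheadTransducer (fun i => e (V i)) k N,
      aheadTransducer_isControlled hN', fun u => ?_, fun u v huv => ?_⟩
    · rw [hdom, list_fin_one_eq_replicate u]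
      cases u.length with
      | zero => simp [SubseqTransducer.eval, SubseqTransducer.evalFrom, aheadTransducer]
      | succ n => simp [aheadTransducer_eval hN' n]
    · rw [hR]
      rw [list_fin_one_eq_replicate u] at huv
      cases hu : u.length with
      | zero => simp [hu, SubseqTransducer.eval, SubseqTransducer.evalFrom, aheadTransducer] at huv
      | succ n =>
        rw [hu, aheadTransducer_eval hN' n] at huv
        obtain rfl := Option.some.inj huv
        have := goodOutput_of_isHelix hV (show 1 ≤ n + 1 by omega)
        simpa [Function.comp_def] using this

/-! ### The instances of the decision problems -/

/-- Used to number the start state 0, the initial state of `FinNFA.ofLists`. -/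
theorem exists_equiv_fin_zero {B : Type} [Finite B] (b : B) :
    ∃ N, ∃ e : B ≃ Fin N, (e b).val = 0 := by
  obtain ⟨N, ⟨e⟩⟩ := Finite.exists_equiv_fin B
  have hN : 0 < N := (e b).pos
  refine ⟨N, e.trans (Equiv.swap (e b) ⟨0, hN⟩), ?_⟩
  simp

theorem syncWord_map {β γ : Type} (g : β → γ) (n : ℕ) (v : List β) :
    (syncWord n v).map (Sum.map id g) = syncWord n (v.map g) := by
  induction n generalizing v with
  | zero => simp [syncWord]
  | succ n ih => cases v <;> simp [syncWord, ih]

section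

variable {A : Type} (δ : A → A → A → A) (blank : A) (H : A → Prop) {N O : ℕ}
  (f : HState (Cell A) ≃ Fin N) (e : Cell A ≃ Fin O)

/-- The numbers of the states of the automaton. -/
def stateNumber : HState (Cell A) ⊕ ℕ → ℕ :=
  Sum.elim (fun p => (f p).val) (N + ·)

theorem stateNumber_injective : Function.Injective (stateNumber f) := by
  rintro (p | i) (q | j) h <;> simp only [stateNumber, Sum.elim_inl, Sum.elim_inr] at h
  · rw [f.injective (Fin.ext h)]
  · have := (f p).isLt
    omega
  · have := (f q).isLt
    omega
  · rw [Nat.add_left_cancel h]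

variable [Finite A]

instance : Finite (HState (Cell A)) :=
  letI := Fintype.ofFinite (Cell A)
  inferInstance

/-- The list of the transitions that do not depend on the input word. -/
noncomputable def fixedTransList : List (ℕ × (Fin 1 ⊕ Fin O) × ℕ) :=
  (Set.toFinite {t : HState (Cell A) × (Fin 1 ⊕ Cell A) × HState (Cell A) |
    FixedTrans δ blank H t.1 t.2.1 t.2.2}).toFinset.toList.map
      fun t => ((f t.1).val, t.2.1.map id e, (f t.2.2).val)

/-- The list of the transitions. -/
noncomputable def transList (x : List A) : List (ℕ × (Fin 1 ⊕ Fin O) × ℕ) :=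
  fixedTransList δ blank H f e ++
    ([((f .two4).val, .inr (e .out), N), (N, .inr (e .out), N),
      (N + x.length, .inr (e .out), N + x.length),
      (N + x.length, .inr (e .wall), (f .end1).val)] ++
    (List.range x.length).map fun j => (N + j, .inr (e (.inn (x.getD j blank))), N + j + 1))

/-- The list of the final states. -/
noncomputable def finalList : List ℕ :=
  (Set.toFinite {p : HState (Cell A) | p.IsFinal = true}).toFinset.toList.map
    fun p => (f p).val

/-- The automaton for the relation. -/
noncomputable def helixAutomaton (x : List A) : FinNFA (Fin 1 ⊕ Fin O) :=
  .ofLists (N + x.length) (transList δ blank H f e x) (finalList f)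

variable {δ blank H f e}

theorem mem_fixedTransList (t : ℕ × (Fin 1 ⊕ Fin O) × ℕ) : t ∈ fixedTransList δ blank H f e ↔
    ∃ p c q, FixedTrans δ blank H p c q ∧ ((f p).val, c.map id e, (f q).val) = t := by
  simp [fixedTransList]

theorem mem_finalList (p : ℕ) : p ∈ finalList f ↔ ∃ q, HState.IsFinal q = true ∧ (f q).val = p := by
  simp [finalList]

theorem mem_transList (x : List A) (t : ℕ × (Fin 1 ⊕ Fin O) × ℕ) :
    t ∈ transList δ blank H f e x ↔ ∃ p c q, HelixTrans δ blank H x p c q ∧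
      (stateNumber f p, c.map id e, stateNumber f q) = t := by
  constructor
  · intro h
    rw [transList, List.mem_append, List.mem_append, mem_fixedTransList, List.mem_map] at h
    rcases h with ⟨p, c, q, h, rfl⟩ | h | ⟨j, hj, rfl⟩
    · exact ⟨_, _, _, .fixed h, rfl⟩
    · simp only [List.mem_cons, List.not_mem_nil, or_false] at h
      rcases h with rfl | rfl | rfl | rfl
      · exact ⟨_, _, _, .enter, rfl⟩
      · exact ⟨_, _, _, .left, rfl⟩
      · exact ⟨_, _, _, .right, rfl⟩
      · exact ⟨_, _, _, .leave, rfl⟩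
    · refine ⟨_, _, _, .read (List.mem_range.1 hj), ?_⟩
      rw [List.getD_eq_getElem _ _ (List.mem_range.1 hj)]
      rfl
  · rintro ⟨p, c, q, h, rfl⟩
    rw [transList, List.mem_append, List.mem_append, mem_fixedTransList, List.mem_map]
    cases h with
    | fixed h => exact Or.inl ⟨_, _, _, h, rfl⟩
    | enter => exact Or.inr (Or.inl (by simp [stateNumber]))
    | left => exact Or.inr (Or.inl (by simp [stateNumber]))
    | right => exact Or.inr (Or.inl (by simp [stateNumber]))
    | leave => exact Or.inr (Or.inl (by simp [stateNumber]))
    | @read j h =>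
      refine Or.inr (Or.inr ⟨j, List.mem_range.2 h, ?_⟩)
      rw [List.getD_eq_getElem _ _ h]
      rfl

theorem transList_le (x : List A) (t : ℕ × (Fin 1 ⊕ Fin O) × ℕ)
    (ht : t ∈ transList δ blank H f e x) : t.1 ≤ N + x.length ∧ t.2.2 ≤ N + x.length := by
  have hf : ∀ p, (f p).val ≤ N + x.length := fun p => (f p).isLt.le.trans (Nat.le_add_right _ _)
  obtain ⟨p, c, q, h, rfl⟩ := (mem_transList x t).1 ht
  cases h <;> (simp [stateNumber, hf]; try omega)

theorem finalList_le (x : List A) (p : ℕ) (hp : p ∈ finalList f) : p ≤ N + x.length := by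
  obtain ⟨q, -, rfl⟩ := (mem_finalList p).1 hp
  exact (f q).isLt.le.trans (Nat.le_add_right _ _)

theorem mem_language_helixAutomaton (h0 : (f .start).val = 0) (x : List A)
    (w : List (Fin 1 ⊕ Fin O)) : w ∈ (helixAutomaton δ blank H f e x).language ↔
      ∃ n v, w = syncWord n v ∧ GoodOutput δ blank H x n (v.map e.symm) := by
  have h1 : w ∈ (helixAutomaton δ blank H f e x).language ↔
      Accepts (HelixTrans δ blank H x) HelixFinal (.inl .start) (w.map (Sum.map id e.symm)) := by
    rw [helixAutomaton, FinNFA.mem_language_ofLists_iff (transList_le x) (finalList_le x), ← h0,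
      ← accepts_comap_iff (f := Sum.map id e.symm) (fun p c q => Iff.rfl)]
    refine accepts_map_iff (f := stateNumber f) (stateNumber_injective f) (fun p' c q' => ?_)
      (fun p' => ?_) (.inl .start) w
    · rw [mem_transList]
      constructor
      · rintro ⟨p, c, q, h, heq⟩
        cases heq
        refine ⟨p, q, rfl, rfl, ?_⟩
        cases c <;> simpa using h
      · rintro ⟨p, q, rfl, rfl, h⟩
        refine ⟨p, _, q, h, ?_⟩
        cases c <;> simp
    · rw [mem_finalList]
      constructor
      · rintro ⟨q, h, rfl⟩
        exact ⟨.inl q, rfl, h⟩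
      · rintro ⟨p | j, rfl, h⟩
        · exact ⟨p, h, rfl⟩
        · exact h.elim
  rw [h1, accepts_helix_iff]
  constructor
  · rintro ⟨n, v, h2, h3⟩
    refine ⟨n, v.map e, ?_, by simpa using h3⟩
    rw [← syncWord_map, ← h2]
    simp
  · rintro ⟨n, v, rfl, h3⟩
    exact ⟨n, v.map e.symm, syncWord_map _ _ _, h3⟩

end

section

variable {A : Type} [Finite A] {δ : A → A → A → A} {blank : A} {H : A → Prop} {N O : ℕ}
  {f : HState (Cell A) ≃ Fin N} {e : Cell A ≃ Fin O}

variable (δ blank H f e) in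
/-- The automatic relation. -/
noncomputable def helixPresentation (h0 : (f .start).val = 0) (x : List A) :
    AutomaticPresentation where
  inSize := 1
  outSize := O
  inSize_pos := one_pos
  outSize_pos := (e .out).pos
  automaton := helixAutomaton δ blank H f e x
  isSynchronous := by
    intro w hw
    obtain ⟨n, v, rfl, h⟩ := (mem_language_helixAutomaton h0 x w).1 hw
    exact syncWord_mem_synchronous n v (by simpa using h.le_length.2)

theorem mem_relation_helixPresentation (h0 : (f .start).val = 0) (x : List A)
    (u : List (Fin 1)) (v : List (Fin O)) :
    (u, v) ∈ (helixPresentation δ blank H f e h0 x).relation ↔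
      GoodOutput δ blank H x u.length (v.map e.symm) := by
  constructor
  · rintro ⟨w, hw, h⟩
    obtain ⟨n, v', rfl, h'⟩ := (mem_language_helixAutomaton h0 x w).1 hw
    cases (syncPair_syncWord n v').symm.trans h
    rw [List.length_replicate]
    exact h'
  · intro h
    refine ⟨_, (mem_language_helixAutomaton h0 x _).2 ⟨_, v, rfl, h⟩,
      (syncPair_syncWord _ v).trans ?_⟩
    rw [← list_fin_one_eq_replicate]

/-- The state numbering puts the chain that reads `x` after the fixed states. Hence the transitions
and final states that do not involve `x` are constants, and only the chain has to be computed from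
the bits of `n`. -/
theorem computable_code_helixPresentation (h0 : (f .start).val = 0) (a₀ : A) (g : Bool → A) :
    Computable fun n : ℕ =>
      (helixPresentation δ blank H f e h0 (a₀ :: n.bits.reverse.map g)).code := by
  let c : A → ℕ := fun a => (e (.inn a)).val
  let F : ℕ → List ℕ := fun n => c a₀ :: n.bits.reverse.map fun b => c (g b)
  have hF : Primrec F := Primrec.list_cons.comp (Primrec.const _)
    (Primrec.list_map (Primrec.list_reverse.comp primrec_natBits)
      ((Primrec.dom_finite fun b => c (g b)).comp Primrec.snd))
  have hlen : Primrec fun n => (F n).length := Primrec.list_length.comp hF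
  have hNl : Primrec fun n => N + (F n).length := Primrec.nat_add.comp (Primrec.const N) hlen
  have hcode : ∀ n, (helixPresentation δ blank H f e h0 (a₀ :: n.bits.reverse.map g)).code =
      (1, O, N + (F n).length + 1, 0,
        (fixedTransList δ blank H f e).map (fun t => (t.1, letterCode t.2.1, t.2.2)) ++
        ([((f .two4).val, Sum.inr (e .out).val, N), (N, Sum.inr (e .out).val, N),
          (N + (F n).length, Sum.inr (e .out).val, N + (F n).length),
          (N + (F n).length, Sum.inr (e .wall).val, (f .end1).val)] ++
        (List.range (F n).length).map fun j => (N + j, Sum.inr ((F n).getD j (c blank)), N + j + 1)),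
        finalList f) := by
    intro n
    have hFn : F n = (a₀ :: n.bits.reverse.map g).map c := by
      simp only [F, List.map_cons, List.map_map, Function.comp_def]
    have hgetD : ∀ j, (F n).getD j (c blank) = c ((a₀ :: n.bits.reverse.map g).getD j blank) := by
      intro j
      rw [hFn]
      exact List.getD_map ..
    have h1 : (helixPresentation δ blank H f e h0 (a₀ :: n.bits.reverse.map g)).code =
        (1, O, (helixAutomaton δ blank H f e (a₀ :: n.bits.reverse.map g)).code letterCode) := rfl
    rw [h1, helixAutomaton, FinNFA.code_ofLists _ (transList_le _) (finalList_le _), transList,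
      List.map_append, List.map_append, List.map_map]
    simp only [hgetD]
    rw [hFn, List.length_map]
    rfl
  simp only [hcode]
  refine Primrec.to_comp ?_
  refine (Primrec.const _).pair ((Primrec.const _).pair ((Primrec.succ.comp hNl).pair
    ((Primrec.const _).pair (Primrec.pair ?_ (Primrec.const _)))))
  refine Primrec.list_append.comp (Primrec.const _) (Primrec.list_append.comp ?_ ?_)
  · exact Primrec.list_cons.comp (Primrec.const _) (Primrec.list_cons.comp (Primrec.const _)
      (Primrec.list_cons.comp (hNl.pair ((Primrec.const _).pair hNl))
        (Primrec.list_cons.comp (hNl.pair (Primrec.const _)) (Primrec.const _))))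
  · have hN2 : Primrec₂ fun (_ j : ℕ) => N + j :=
      (Primrec.nat_add.comp (Primrec.const N) Primrec.snd).to₂
    refine Primrec.list_map (Primrec.list_range.comp hlen) ?_
    refine Primrec.pair hN2 (Primrec.pair ?_ (Primrec.succ.comp hN2))
    exact Primrec.sumInr.comp ((Primrec.list_getD (c blank)).comp (hF.comp Primrec.fst) Primrec.snd)

end

/-- The algorithm may diverge on words that code no instance, but along `I` it only meets codes, so
the composition is total. -/
theorem computablePred_of_isDecidableProblem {ι C : Type} [Primcodable C] {code : ι → C}
    {Q : ι → Prop} (h : IsDecidableProblem code Q) (I : ℕ → ι)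
    (hI : Computable fun n => code (I n)) : ComputablePred fun n => Q (I n) := by
  obtain ⟨F, hF, hFQ⟩ := h
  choose b hb hbQ using fun n => hFQ (I n)
  refine ComputablePred.computable_iff.2 ⟨b, ?_, ?_⟩
  · refine (hF.comp hI).of_eq fun n => Part.eq_some_iff.2 (hb n)
  · funext n
    exact propext (hbQ n).symm

theorem mainTheorem4 :
    ¬ IsDecidableProblem ControlInstance.code
        (fun I => HasControlledUniformization I.1.relation (controlSync I.2.language)) ∧
    ¬ IsDecidableProblem SyncInstance.code
        (fun I => HasControlledUniformization I.1.relation I.2.language) := by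
  obtain ⟨A, _, blank, δ, H, a₀, g, hδ, hH, hA⟩ := exists_cellularAutomaton_undecidable
  obtain ⟨N, f, h0⟩ := exists_equiv_fin_zero (HState.start : HState (Cell A))
  obtain ⟨O, ⟨e⟩⟩ := Finite.exists_equiv_fin (Cell A)
  have hP := fun n : ℕ => hasControlledUniformization_iff hδ hH
    (List.cons_ne_nil a₀ (n.bits.reverse.map g)) e _
    (mem_relation_helixPresentation (δ := δ) (blank := blank) (H := H) (e := e) h0 _)
  have hcode := computable_code_helixPresentation (δ := δ) (blank := blank) (H := H) (e := e)
    h0 a₀ g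
  constructor <;> intro h <;> apply hA
  · have := computablePred_of_isDecidableProblem h
      (fun n => (helixPresentation δ blank H f e h0 (a₀ :: n.bits.reverse.map g), aheadAutomaton))
      (hcode.pair (Computable.const (aheadAutomaton.code Tape.toNat)))
    exact this.of_eq hP
  · have := computablePred_of_isDecidableProblem h
      (fun n => ⟨helixPresentation δ blank H f e h0 (a₀ :: n.bits.reverse.map g),
        aheadAutomaton.controlSync⟩)
      (hcode.pair (Computable.const
        ((aheadAutomaton.controlSync : FinNFA (Fin 1 ⊕ Fin O)).code letterCode)))
    refine this.of_eq fun n => ?_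
    rw [← hP n]
    exact iff_of_eq (congrArg _ (FinNFA.language_controlSync _))
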